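/- For a metric space $\Gamma$, balls are closed, $B(x,r)=\{y\in\Gamma: d(x,y)\le r\}$, and are considered together with their center and radius. $\Gamma$ is doubling with constant $N$ if every ball of radius $r>0$ can be covered by at most $N$ balls of radius $r/2$. An $\varepsilon$-net of $\Gamma$ is a set $X\subseteq\Gamma$ such that $d(x,x')>\varepsilon$ for all distinct $x,x'\in X$ and every point of $\Gamma$ is within distance $\varepsilon$ of a point of $X$. A multiresolution family on $\Gamma$ with inflation factor $A>1$ is a family $\mathscr G=\{B(x,A2^{-n}): n\in\mathbb Z,\ x\in X_n\}$, where, for each $n\in\mathbb Z$, $X_n$ is a $2^{-n}$-net of $\Gamma$ and $X_n\subseteq X_{n+1}$. For a triple of points let $\partial_1(x_1,x_2,x_3)=d(x_1,x_2)+d(x_2,x_3)-d(x_1,x_3)$ and $\partial(x_1,x_2,x_3)=\min_{\sigma\in S_3}\partial_1(x_{\sigma(1)},x_{\sigma(2)},x_{\sigma(3)})$, and for a ball $B$ of radius $r$ let $\beta_\infty(B)\ge 0$ be given by $\beta_\infty(B)^2=r^{-1}\sup\{\partial(x,y,z):x,y,z\in B\}$. Let $\mathcal H^1$ be the one-dimensional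 Hausdorff measure. (1) For all $p>2$, $N\in\mathbb N$ and $A>1$ there is a constant $C<\infty$, depending only on $p$, $N$ and $A$, such that for every connected metric space $\Gamma$ that is doubling with constant $N$ and every multiresolution family $\mathscr G$ on $\Gamma$ with inflation factor $A$, $$\sum_{B\in\mathscr G}\beta_\infty(B)^p\,\mathrm{diam}(B)\le C\,\mathcal H^1(\Gamma).$$ (2) The statement fails for $p=2$: there is an $N\in\mathbb N$ such that for every $A>1$ and every constant $C<\infty$ there are a connected metric space $\Gamma$ that is doubling with constant $N$ and a multiresolution family $\mathscr G$ on $\Gamma$ with inflation factor $A$ for which $$\sum_{B\in\mathscr G}\beta_\infty(B)^2\,\mathrm{diam}(B)> C\,\mathcal H^1(\Gamma).$$ -/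

import Mathlib

open MeasureTheory Metric
open scoped ENNReal NNReal

noncomputable section

/-- A metric space is doubling with constant `N` if every closed ball of radius `r` can be covered
by at most `N` closed balls of radius `r / 2`. -/
def IsDoublingWith (Γ : Type*) [MetricSpace Γ] (N : ℕ) : Prop :=
  ∀ (x : Γ) (r : ℝ), 0 < r →
    ∃ t : Finset Γ, t.card ≤ N ∧ closedBall x r ⊆ ⋃ y ∈ t, closedBall y (r / 2)

/-- `X` is an `ε`-net of the metric space `Γ`: distinct points of `X` are at distance greater
than `ε`, and every point of `Γ` is within distance `ε` of a point of `X`. -/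
structure IsEpsNet {Γ : Type*} [MetricSpace Γ] (ε : ℝ) (X : Set Γ) : Prop where
  separated : ∀ x ∈ X, ∀ y ∈ X, x ≠ y → ε < dist x y
  covers : ∀ y : Γ, ∃ x ∈ X, dist x y ≤ ε

/-- A nested sequence, indexed by all integers `n`, of `2⁻ⁿ`-nets of `Γ`; the nets grow as the
scale `2⁻ⁿ` decreases. -/
structure IsNestedNets {Γ : Type*} [MetricSpace Γ] (X : ℤ → Set Γ) : Prop where
  isEpsNet : ∀ n : ℤ, IsEpsNet ((2 : ℝ) ^ (-n)) (X n)
  nested : ∀ n : ℤ, X n ⊆ X (n + 1)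

/-- The multiresolution family of balls `B(x, A 2⁻ⁿ)`, `x ∈ X n`, `n ∈ ℤ`, with inflation factor
`A`. A ball is recorded as the pair (center, radius). -/
def multiresolutionFamily {Γ : Type*} (A : ℝ) (X : ℤ → Set Γ) : Set (Γ × ℝ) :=
  {B | ∃ n : ℤ, B.1 ∈ X n ∧ B.2 = A * (2 : ℝ) ^ (-n)}

/-- The set of points of the closed ball with given center and radius. -/
def ballSet {Γ : Type*} [MetricSpace Γ] (B : Γ × ℝ) : Set Γ := closedBall B.1 B.2

/-- The ordered triangle inequality defect `∂₁`. -/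
def orderedDefect {Γ : Type*} [MetricSpace Γ] (x y z : Γ) : ℝ :=
  dist x y + dist y z - dist x z

/-- The unordered triangle inequality defect `∂`: the minimum of `∂₁` over all orderings. -/
def defect {Γ : Type*} [MetricSpace Γ] (x y z : Γ) : ℝ :=
  ⨅ σ : Equiv.Perm (Fin 3),
    orderedDefect (![x, y, z] (σ 0)) (![x, y, z] (σ 1)) (![x, y, z] (σ 2))

/-- The number `β_∞(B)`, where `β_∞(B)² = r⁻¹ sup {∂(x, y, z) : x, y, z ∈ B}` for a ball `B` of
radius `r`. -/
def betaInf {Γ : Type*} [MetricSpace Γ] (B : Γ × ℝ) : ℝ≥0∞ :=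
  ((ENNReal.ofReal B.2)⁻¹ *
    ⨆ x ∈ ballSet B, ⨆ y ∈ ballSet B, ⨆ z ∈ ballSet B, ENNReal.ofReal (defect x y z)) ^ (1 / 2 : ℝ)

/-- The sum `∑ β_∞(B)ᵖ diam(B)` over the balls `B` of the multiresolution family. -/
def betaSum {Γ : Type*} [MetricSpace Γ] (p A : ℝ) (X : ℤ → Set Γ) : ℝ≥0∞ :=
  ∑' B : multiresolutionFamily A X, betaInf B.1 ^ p * ediam (ballSet B.1)

end

/-! The balls are sorted by their relative defect. If the balls with a triple of defect more than
`2⁻ⁱ r`, where `r` is the radius, have total radius at most `C (i + 1) 2ⁱ` times the length of the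
space (`sum_radius_hasDefect_le`), then the sum of the `β_∞ᵖ diam` is bounded by that length times
`∑ (i + 1) 2ⁱ 2^(-ip/2)`, which converges exactly because `p > 2`.

For a finite set of such balls the space is replaced by a fine net, which has at most
`2 ℋ¹(Γ) / s` points at scale `s` because a ball that does not exhaust a connected space has
length at least its radius, and which is visited by a periodic walk of length comparable to `ℋ¹(Γ)`
(`exists_periodic_walk`). With `ε = 2⁻ⁱ`, a ball with a triple of defect more than `ε r` is of
one of two kinds (`isBent_or_exists_isFork`).

* It is *bent*: an arc of the walk near the ball has a defect comparable to `ε r`. Going from fine to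
  coarse scales with ratio about `2⁻ⁱ`, the walk is shortened by skipping these arcs. Each skip
  shortens it by a multiple of `ε r`, and the modified walk stays so close to the original one that
  the defects at coarser scales survive. Hence the `ε r` sum up to at most the length of the walk
  (`sum_isBent_le`); the `i + 18` residue classes of scales give the factor linear in `i`.
* Otherwise the arc through the center is almost a geodesic, but some point of the triple is
  off it, at a distance `δ` between about `ε r` and `r`. The ball of radius `R` comparable to `δ`
  at the closest point of the arc is a *fork*: it contains an arc of diameter almost `2 R` and a
  definite amount of length away from that arc. A covering weight is collapsed, again from fine
  to coarse scales, to weight `2 R` on each fork, which loses at least `R / 16` of weight, so the radii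
  of the forks sum up to at most a multiple of the length (`sum_isFork_le`). Here the constants are
  absolute; the factor `2ⁱ` comes from charging balls of radius `r ≤ 5 R / ε` to forks.

For `p = 2` the example is a comb with a base of length `3` and `2ᵃ` generations of spikes, in the
`ℓ¹` plane. The spikes of generation `k` have height `h = 2⁻ᵃ⁽ᵏ⁺¹⁾` and spacing `2ᵃ h`, so that all
spikes together have total length one. At each of the about `a` scales between `h` and `2ᵃ h`,
each spike lies in a ball with defect at least `2 h`, so that the sum for `p = 2` is at least a multiple of `a`
(`le_betaSum_comb`), while the length stays at most `4`. -/

/-! ### Triangle inequality defects -/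

section Defect

variable {Γ : Type*} [MetricSpace Γ]

theorem orderedDefect_comm (x y z : Γ) : orderedDefect z y x = orderedDefect x y z := by
  unfold orderedDefect
  rw [dist_comm z y, dist_comm y x, dist_comm z x]
  ring

theorem orderedDefect_le_add {x y z x' y' z' : Γ} {s : ℝ} (hx : dist x x' ≤ s)
    (hy : dist y y' ≤ s) (hz : dist z z' ≤ s) :
    orderedDefect x y z ≤ orderedDefect x' y' z' + 6 * s := by
  unfold orderedDefect
  have h1 := dist_triangle4 x x' y' y
  have h2 := dist_triangle4 y y' z' z
  have h3 := dist_triangle4 x' x z z'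
  rw [dist_comm y' y] at h1
  rw [dist_comm z' z] at h2
  rw [dist_comm x' x] at h3
  linarith

theorem defect_le (x y z : Γ) (σ : Equiv.Perm (Fin 3)) :
    defect x y z ≤
      orderedDefect (![x, y, z] (σ 0)) (![x, y, z] (σ 1)) (![x, y, z] (σ 2)) :=
  ciInf_le (Set.finite_range _).bddBelow σ

theorem defect_le_orderedDefect (x y z : Γ) : defect x y z ≤ orderedDefect x y z := by
  simpa using defect_le x y z 1

theorem defect_le_orderedDefect_left (x y z : Γ) : defect x y z ≤ orderedDefect y x z := by
  have h := defect_le x y z (Equiv.swap 0 1)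
  rwa [show (Equiv.swap (0 : Fin 3) 1) 0 = 1 by decide,
    show (Equiv.swap (0 : Fin 3) 1) 1 = 0 by decide,
    show (Equiv.swap (0 : Fin 3) 1) 2 = 2 by decide] at h

theorem defect_le_orderedDefect_right (x y z : Γ) : defect x y z ≤ orderedDefect x z y := by
  have h := defect_le x y z (Equiv.swap 1 2)
  rwa [show (Equiv.swap (1 : Fin 3) 2) 0 = 0 by decide,
    show (Equiv.swap (1 : Fin 3) 2) 1 = 2 by decide,
    show (Equiv.swap (1 : Fin 3) 2) 2 = 1 by decide] at h

/-- The defect only depends on which point is put in the middle, so three orderings bound it. -/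
theorem le_defect {x y z : Γ} {c : ℝ} (h1 : c ≤ orderedDefect x y z)
    (h2 : c ≤ orderedDefect y x z) (h3 : c ≤ orderedDefect x z y) : c ≤ defect x y z := by
  refine le_ciInf fun σ => ?_
  have key : ∀ σ : Equiv.Perm (Fin 3),
      (σ 0 = 0 ∧ σ 1 = 1 ∧ σ 2 = 2) ∨ (σ 0 = 2 ∧ σ 1 = 1 ∧ σ 2 = 0) ∨
      (σ 0 = 1 ∧ σ 1 = 0 ∧ σ 2 = 2) ∨ (σ 0 = 2 ∧ σ 1 = 0 ∧ σ 2 = 1) ∨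
      (σ 0 = 0 ∧ σ 1 = 2 ∧ σ 2 = 1) ∨ (σ 0 = 1 ∧ σ 1 = 2 ∧ σ 2 = 0) := by decide
  rcases key σ with h | h | h | h | h | h <;> obtain ⟨a, b, d⟩ := h <;> rw [a, b, d]
  · exact h1
  · exact (orderedDefect_comm x y z).symm ▸ h1
  · exact h2
  · exact (orderedDefect_comm y x z).symm ▸ h2
  · exact h3
  · exact (orderedDefect_comm x z y).symm ▸ h3

theorem defect_le_dist (x y z : Γ) : defect x y z ≤ dist x y := by
  have h1 := defect_le_orderedDefect x y z
  have h2 := defect_le_orderedDefect_left x y z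
  unfold orderedDefect at h1 h2
  rw [dist_comm y x] at h2
  linarith

/-- If three points are approximated by points of a path, then their defect is controlled by the
ordered defects of the path. -/
theorem defect_le_of_path {g : ℕ → Γ} {a b : ℕ} {e s : ℝ}
    (hflat : ∀ t₁ t₂ t₃, a ≤ t₁ → t₁ ≤ t₂ → t₂ ≤ t₃ → t₃ ≤ b →
      orderedDefect (g t₁) (g t₂) (g t₃) ≤ e)
    {x y z : Γ} (hx : ∃ t, a ≤ t ∧ t ≤ b ∧ dist x (g t) ≤ s)
    (hy : ∃ t, a ≤ t ∧ t ≤ b ∧ dist y (g t) ≤ s)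
    (hz : ∃ t, a ≤ t ∧ t ≤ b ∧ dist z (g t) ≤ s) : defect x y z ≤ e + 6 * s := by
  obtain ⟨i, ai, ib, hi⟩ := hx
  obtain ⟨j, aj, jb, hj⟩ := hy
  obtain ⟨k, ak, kb, hk⟩ := hz
  have d1 := defect_le_orderedDefect x y z
  have d2 := defect_le_orderedDefect_left x y z
  have d3 := defect_le_orderedDefect_right x y z
  have e1 := orderedDefect_le_add hi hj hk
  have e2 := orderedDefect_le_add hj hi hk
  have e3 := orderedDefect_le_add hi hk hj
  rcases le_total i j with h | h <;> rcases le_total j k with h' | h' <;>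
    rcases le_total i k with h'' | h''
  · linarith [hflat i j k ai h h' kb]
  · linarith [hflat i j k ai h h' kb]
  · linarith [hflat i k j ai h'' h' jb]
  · have := hflat k i j ak h'' h jb
    rw [← orderedDefect_comm] at this
    linarith
  · linarith [hflat j i k aj h h'' kb]
  · have := hflat j k i aj h' h'' ib
    rw [← orderedDefect_comm] at this
    linarith
  · have := hflat k j i ak h' h ib
    rw [← orderedDefect_comm] at this
    linarith
  · have := hflat k j i ak h' h ib
    rw [← orderedDefect_comm] at this
    linarith

end Defect

/-! ### Counting separated points -/

section Counting

/-- A doubling space contains few points that are separated at a scale comparable to the radius of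
a ball containing them. -/
theorem IsDoublingWith.card_le {Γ : Type*} [MetricSpace Γ] {N : ℕ} (hΓ : IsDoublingWith Γ N)
    {s : ℝ} (hs : 0 < s) (k : ℕ) (x : Γ) (F : Finset Γ)
    (hsep : ∀ y ∈ F, ∀ z ∈ F, y ≠ z → s < dist y z)
    (hF : ∀ y ∈ F, dist y x ≤ 2 ^ k * (s / 2)) : F.card ≤ N ^ k := by
  classical
  induction k generalizing x F with
  | zero =>
    rw [pow_zero, Finset.card_le_one]
    intro y hy z hz
    by_contra hne
    have h1 := hsep y hy z hz hne
    have h2 := hF y hy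
    have h3 := hF z hz
    have h4 := dist_triangle_right y z x
    norm_num at h2 h3
    linarith
  | succ k ih =>
    obtain ⟨t, ht, hcov⟩ := hΓ x (2 ^ (k + 1) * (s / 2)) (by positivity)
    have hsub : F ⊆ t.biUnion fun c => F.filter fun y => dist y c ≤ 2 ^ k * (s / 2) := by
      intro y hy
      have := hcov (mem_closedBall.2 (hF y hy))
      simp only [Set.mem_iUnion, mem_closedBall] at this
      obtain ⟨c, hc, hyc⟩ := this
      simp only [Finset.mem_biUnion, Finset.mem_filter]
      refine ⟨c, hc, hy, hyc.trans_eq ?_⟩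
      ring
    calc F.card ≤ _ := Finset.card_le_card hsub
      _ ≤ ∑ c ∈ t, (F.filter fun y => dist y c ≤ 2 ^ k * (s / 2)).card := Finset.card_biUnion_le
      _ ≤ ∑ c ∈ t, N ^ k := by
        refine Finset.sum_le_sum fun c _ => ih c _ ?_ ?_
        · intro y hy z hz
          exact hsep y (Finset.mem_filter.1 hy).1 z (Finset.mem_filter.1 hz).1
        · intro y hy
          exact (Finset.mem_filter.1 hy).2
      _ = t.card * N ^ k := by rw [Finset.sum_const, smul_eq_mul]
      _ ≤ N * N ^ k := Nat.mul_le_mul_right _ ht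
      _ = N ^ (k + 1) := by ring

/-- Every finite set contains a `D`-separated subset that is `D`-dense in it. -/
theorem exists_separated_subset {Γ : Type*} [MetricSpace Γ] {D : ℝ} (hD : 0 ≤ D) (S : Finset Γ) :
    ∃ S' ⊆ S, (∀ y ∈ S', ∀ z ∈ S', y ≠ z → D < dist y z) ∧
      ∀ x ∈ S, ∃ y ∈ S', dist x y ≤ D := by
  classical
  induction S using Finset.induction_on with
  | empty => exact ⟨∅, subset_rfl, by simp, by simp⟩
  | insert a S ha ih =>
    obtain ⟨S', hsub, hsep, hden⟩ := ih
    by_cases h : ∃ y ∈ S', dist a y ≤ D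
    · refine ⟨S', hsub.trans (Finset.subset_insert _ _), hsep, ?_⟩
      intro x hx
      rcases Finset.mem_insert.1 hx with rfl | hx
      · exact h
      · exact hden x hx
    · push Not at h
      refine ⟨insert a S', Finset.insert_subset_insert _ hsub, ?_, ?_⟩
      · intro y hy z hz hne
        rcases Finset.mem_insert.1 hy with hy | hy <;> rcases Finset.mem_insert.1 hz with hz | hz
        · exact absurd (hy.trans hz.symm) hne
        · exact hy ▸ h z hz
        · rw [dist_comm]; exact hz ▸ h y hy
        · exact hsep y hy z hz hne
      · intro x hx
        rcases Finset.mem_insert.1 hx with rfl | hx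
        · exact ⟨x, Finset.mem_insert_self _ _, by simpa using hD⟩
        · obtain ⟨y, hy, hxy⟩ := hden x hx
          exact ⟨y, Finset.mem_insert_of_mem hy, hxy⟩

/-- A sum over a range is controlled by the sums over the arithmetic progressions of step `m`. -/
theorem sum_range_le_of_progressions {F : ℕ → ℝ} (hF : ∀ k, 0 ≤ F k) {m : ℕ} (hm : 0 < m) {W : ℝ}
    (hW : ∀ c L, ∑ l ∈ Finset.range L, F (c + m * l) ≤ W) (Q : ℕ) :
    ∑ k ∈ Finset.range Q, F k ≤ m * W := by
  classical
  have h1 : ∑ k ∈ Finset.range Q, F k ≤ ∑ k ∈ Finset.range (m * Q), F k :=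
    Finset.sum_le_sum_of_subset_of_nonneg
      (Finset.range_subset_range.2 (Nat.le_mul_of_pos_left Q hm)) fun _ _ _ => hF _
  have h2 : ∑ k ∈ Finset.range (m * Q), F k
      = ∑ c ∈ Finset.range m, ∑ l ∈ Finset.range Q, F (c + m * l) := by
    rw [← Finset.sum_product']
    symm
    refine Finset.sum_nbij' (fun p => p.1 + m * p.2) (fun k => (k % m, k / m)) ?_ ?_ ?_ ?_ ?_
    · rintro ⟨c, l⟩ h
      simp only [Finset.mem_product, Finset.mem_range] at h ⊢
      calc c + m * l < m * (l + 1) := by rw [mul_add]; omega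
        _ ≤ m * Q := Nat.mul_le_mul_left _ h.2
    · intro k hk
      simp only [Finset.mem_product, Finset.mem_range] at hk ⊢
      exact ⟨Nat.mod_lt _ hm, Nat.div_lt_of_lt_mul hk⟩
    · rintro ⟨c, l⟩ h
      simp only [Finset.mem_product, Finset.mem_range] at h
      simp [Nat.mod_eq_of_lt h.1, Nat.add_mul_div_left _ _ hm, Nat.div_eq_of_lt h.1]
    · intro k _
      exact Nat.mod_add_div k m
    · intros; rfl
  calc _ ≤ _ := h1
    _ = _ := h2
    _ ≤ ∑ c ∈ Finset.range m, W := Finset.sum_le_sum fun c _ => hW c Q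
    _ = m * W := by simp

/-- A sum of distinct numbers `A 2⁻ⁿ` is at most twice an upper bound for its terms. -/
theorem sum_zpow_le (I : Finset ℤ) {A y : ℝ} (hA : 0 ≤ A) (hy : 0 ≤ y)
    (h : ∀ n ∈ I, A * (2 : ℝ) ^ (-n) ≤ y) : ∑ n ∈ I, A * (2 : ℝ) ^ (-n) ≤ 2 * y := by
  classical
  rcases I.eq_empty_or_nonempty with rfl | hI
  · simpa using hy
  set n₀ := I.min' hI with hn₀
  have hmin : ∀ n ∈ I, n₀ ≤ n := fun n hn => I.min'_le n hn
  have h1 : ∀ n ∈ I, A * (2 : ℝ) ^ (-n) = A * 2 ^ (-n₀) * (1 / 2) ^ (n - n₀).toNat := by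
    intro n hn
    have h2 : ((n - n₀).toNat : ℤ) = n - n₀ := Int.toNat_of_nonneg (by linarith [hmin n hn])
    rw [one_div, inv_pow, ← zpow_natCast, h2, ← zpow_neg, mul_assoc, ← zpow_add₀ (by norm_num)]
    congr 2
    ring
  rw [Finset.sum_congr rfl h1, ← Finset.mul_sum]
  have h3 : ∑ n ∈ I, (1 / 2 : ℝ) ^ (n - n₀).toNat ≤ 2 := by
    have hinj : Set.InjOn (fun n : ℤ => (n - n₀).toNat) I := by
      intro a ha b hb hab
      have h4 := hmin a ha
      have h5 := hmin b hb
      simp only at hab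
      omega
    rw [← Finset.sum_image (f := fun k : ℕ => (1 / 2 : ℝ) ^ k) hinj]
    have hs : Summable fun k : ℕ => (1 / 2 : ℝ) ^ k := summable_geometric_two
    exact (hs.sum_le_tsum _ fun _ _ => by positivity).trans_eq tsum_geometric_two
  have h6 := h n₀ (I.min'_mem hI)
  have h7 : 0 ≤ A * (2 : ℝ) ^ (-n₀) := by positivity
  nlinarith

end Counting

/-! ### Shortening a walk at successive scales -/

section Walk

variable {Γ : Type*} [MetricSpace Γ]

/-- The length of the first `T` steps of a walk. -/
noncomputable def walkLength (T : ℕ) (f : ℕ → Γ) : ℝ :=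
  ∑ t ∈ Finset.range T, dist (f t) (f (t + 1))

theorem walkLength_nonneg (T : ℕ) (f : ℕ → Γ) : 0 ≤ walkLength T f :=
  Finset.sum_nonneg fun _ _ => dist_nonneg

/-- The walk that jumps from time `a` directly to the position at time `b`. -/
def skip (f : ℕ → Γ) (a b : ℕ) : ℕ → Γ := fun t => if a < t ∧ t ≤ b then f b else f t

theorem walkLength_skip_add_le {T : ℕ} (f : ℕ → Γ) {a c b : ℕ} (hac : a ≤ c) (hcb : c ≤ b)
    (hbT : b ≤ T) :
    walkLength T (skip f a b) + orderedDefect (f a) (f c) (f b) ≤ walkLength T f := by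
  have hsplit : ∀ u : ℕ → ℝ, ∑ t ∈ Finset.range T, u t =
      ∑ t ∈ Finset.range a, u t + ∑ t ∈ Finset.Ico a b, u t + ∑ t ∈ Finset.Ico b T, u t := by
    intro u
    rw [Finset.range_eq_Ico, Finset.range_eq_Ico,
      Finset.sum_Ico_consecutive u (Nat.zero_le a) (hac.trans hcb),
      Finset.sum_Ico_consecutive u (Nat.zero_le b) hbT]
  have hmid : ∑ t ∈ Finset.Ico a b, dist (skip f a b t) (skip f a b (t + 1)) ≤
      dist (f a) (f b) := by
    rcases (hac.trans hcb).eq_or_lt with h | h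
    · subst h; simp
    · rw [Finset.sum_eq_sum_Ico_succ_bot h]
      have h0 : ∑ t ∈ Finset.Ico (a + 1) b, dist (skip f a b t) (skip f a b (t + 1)) = 0 := by
        refine Finset.sum_eq_zero fun t ht => ?_
        rw [Finset.mem_Ico] at ht
        simp only [skip]
        rw [if_pos ⟨by omega, by omega⟩, if_pos ⟨by omega, by omega⟩, dist_self]
      rw [h0, add_zero]
      simp only [skip]
      rw [if_neg (by omega), if_pos ⟨by omega, by omega⟩]
  have hmid' : dist (f a) (f c) + dist (f c) (f b) ≤
      ∑ t ∈ Finset.Ico a b, dist (f t) (f (t + 1)) := by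
    rw [← Finset.sum_Ico_consecutive _ hac hcb]
    exact add_le_add (dist_le_Ico_sum_dist f hac) (dist_le_Ico_sum_dist f hcb)
  have hleft : ∑ t ∈ Finset.range a, dist (skip f a b t) (skip f a b (t + 1)) =
      ∑ t ∈ Finset.range a, dist (f t) (f (t + 1)) := by
    refine Finset.sum_congr rfl fun t ht => ?_
    rw [Finset.mem_range] at ht
    simp only [skip]
    rw [if_neg (by omega), if_neg (by omega)]
  have hright : ∑ t ∈ Finset.Ico b T, dist (skip f a b t) (skip f a b (t + 1)) =
      ∑ t ∈ Finset.Ico b T, dist (f t) (f (t + 1)) := by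
    refine Finset.sum_congr rfl fun t ht => ?_
    rw [Finset.mem_Ico] at ht
    have h1 : skip f a b t = f t := by
      simp only [skip]
      split_ifs with h
      · rw [show t = b by omega]
      · rfl
    rw [h1]
    simp only [skip]
    rw [if_neg (by omega)]
  unfold walkLength orderedDefect
  rw [hsplit, hsplit, hleft, hright]
  linarith

/-- Skipping finitely many disjoint time intervals simultaneously: the length drops by at least
the sum of the defects along the intervals. -/
theorem exists_skip {T : ℕ} (f : ℕ → Γ) (S : Finset Γ) (a c b : Γ → ℕ)
    (hac : ∀ x ∈ S, a x ≤ c x) (hcb : ∀ x ∈ S, c x ≤ b x) (hbT : ∀ x ∈ S, b x ≤ T)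
    (hdisj : ∀ x ∈ S, ∀ y ∈ S, x ≠ y → ∀ t, a x ≤ t → t ≤ b x → ¬(a y ≤ t ∧ t ≤ b y)) :
    ∃ f' : ℕ → Γ, (∀ t, f' t = f t ∨ ∃ x ∈ S, a x < t ∧ t ≤ b x ∧ f' t = f (b x)) ∧
      walkLength T f' + ∑ x ∈ S, orderedDefect (f (a x)) (f (c x)) (f (b x)) ≤ walkLength T f := by
  classical
  induction S using Finset.induction_on with
  | empty => exact ⟨f, fun t => Or.inl rfl, by simp⟩
  | insert y S hy ih =>
    obtain ⟨f', hf', hlen⟩ := ih (fun x hx => hac x (Finset.mem_insert_of_mem hx))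
      (fun x hx => hcb x (Finset.mem_insert_of_mem hx))
      (fun x hx => hbT x (Finset.mem_insert_of_mem hx))
      (fun x hx z hz => hdisj x (Finset.mem_insert_of_mem hx) z (Finset.mem_insert_of_mem hz))
    have hyS := Finset.mem_insert_self y S
    have hsame : ∀ t, a y ≤ t → t ≤ b y → f' t = f t := by
      intro t h1 h2
      rcases hf' t with h | ⟨x, hx, h3, h4, _⟩
      · exact h
      · exact absurd ⟨h3.le, h4⟩ (hdisj y hyS x (Finset.mem_insert_of_mem hx)
          (fun h => hy (h ▸ hx)) t h1 h2)
    refine ⟨skip f' (a y) (b y), fun t => ?_, ?_⟩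
    · by_cases h : a y < t ∧ t ≤ b y
      · refine Or.inr ⟨y, hyS, h.1, h.2, ?_⟩
        simp only [skip]
        rw [if_pos h, hsame _ ((hac y hyS).trans (hcb y hyS)) le_rfl]
      · simp only [skip]
        rw [if_neg h]
        rcases hf' t with h1 | ⟨x, hx, h3⟩
        · exact Or.inl h1
        · exact Or.inr ⟨x, Finset.mem_insert_of_mem hx, h3⟩
    · have h1 := walkLength_skip_add_le f' (hac y hyS) (hcb y hyS) (hbT y hyS)
      rw [hsame _ le_rfl ((hac y hyS).trans (hcb y hyS)), hsame _ (hac y hyS) (hcb y hyS),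
        hsame _ ((hac y hyS).trans (hcb y hyS)) le_rfl] at h1
      rw [Finset.sum_insert hy]
      linarith

/-- `IsBent g T x r e` says that, before time `T`, the walk `g` has an arc inside the ball
`B(x, 6r)` along which a triple of points, in the order of the walk, has defect at least `e`. -/
def IsBent (g : ℕ → Γ) (T : ℕ) (x : Γ) (r e : ℝ) : Prop :=
  ∃ a c b, a ≤ c ∧ c ≤ b ∧ b ≤ T ∧ (∀ t, a ≤ t → t ≤ b → dist (g t) x ≤ 6 * r) ∧
    e ≤ orderedDefect (g a) (g c) (g b)

/-- Bent balls at sparse scales, indexed from the finest to the coarsest and separated at each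
scale, have a total defect bounded by the length of the walk: the walk is shortened scale after
scale, and at each scale it stays so close to the original one that the defects survive. -/
theorem sum_isBent_le {g : ℕ → Γ} {T : ℕ} {S : ℕ → Finset Γ} {r e D : ℕ → ℝ} (hr : ∀ l, 0 ≤ r l)
    (hD0 : 0 ≤ D 0) (hDr : ∀ l, D l + 12 * r l ≤ D (l + 1)) (hDe : ∀ l, 12 * D l ≤ e l)
    (hsep : ∀ l, ∀ x ∈ S l, ∀ y ∈ S l, x ≠ y → 12 * r l < dist x y)
    (hbent : ∀ l, ∀ x ∈ S l, IsBent g T x (r l) (e l)) (L : ℕ) :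
    ∑ l ∈ Finset.range L, (S l).card * (e l / 2) ≤ walkLength T g := by
  suffices h : ∃ f : ℕ → Γ, (∀ t, dist (f t) (g t) ≤ D L) ∧
      walkLength T f + ∑ l ∈ Finset.range L, (S l).card * (e l / 2) ≤ walkLength T g by
    obtain ⟨f, _, hf⟩ := h
    linarith [walkLength_nonneg T f]
  induction L with
  | zero => exact ⟨g, by simpa using hD0, by simp⟩
  | succ L ih =>
    obtain ⟨f, hfg, hlen⟩ := ih
    choose! a c b hac hcb hbT hball hdef using hbent L
    obtain ⟨f', hf', hlen'⟩ := exists_skip (T := T) f (S L) a c b hac hcb hbT (by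
      intro x hx y hy hne t h1 h2 h3
      have h4 := hball x hx t h1 h2
      have h5 := hball y hy t h3.1 h3.2
      have h6 := hsep L x hx y hy hne
      have h7 := dist_triangle_left x y (g t)
      linarith)
    refine ⟨f', fun t => ?_, ?_⟩
    · rcases hf' t with h | ⟨x, hx, h1, h2, h3⟩
      · rw [h]
        linarith [hfg t, hDr L, hr L]
      · rw [h3]
        have h4 := hball x hx t h1.le h2
        have h5 := hball x hx (b x) ((hac x hx).trans (hcb x hx)) le_rfl
        have h6 := dist_triangle_right (g (b x)) (g t) x
        have h7 := dist_triangle (f (b x)) (g (b x)) (g t)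
        linarith [hfg (b x), hDr L]
    · have hsum : (S L).card * (e L / 2) ≤
          ∑ x ∈ S L, orderedDefect (f (a x)) (f (c x)) (f (b x)) := by
        rw [← nsmul_eq_mul]
        refine Finset.card_nsmul_le_sum _ _ _ fun x hx => ?_
        have h1 := hdef x hx
        have h2 := orderedDefect_le_add (x := g (a x)) (x' := f (a x)) (y := g (c x))
          (y' := f (c x)) (z := g (b x)) (z' := f (b x)) (s := D L)
          (by rw [dist_comm]; exact hfg _) (by rw [dist_comm]; exact hfg _)
          (by rw [dist_comm]; exact hfg _)
        linarith [hDe L]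
      rw [Finset.sum_range_succ]
      linarith

end Walk

/-! ### Collapsing mass at successive scales -/

section Fork

/-- If finitely many intervals cover `[0, D]`, then their total length is at least `D`. -/
theorem le_sum_of_Icc_cover {ι : Type*} (F : Finset ι) (c ρ : ι → ℝ) (hρ : ∀ i ∈ F, 0 ≤ ρ i)
    {D : ℝ} (h : ∀ s, 0 ≤ s → s ≤ D → ∃ i ∈ F, |s - c i| ≤ ρ i) : D ≤ ∑ i ∈ F, 2 * ρ i := by
  have hsub : Set.Icc 0 D ⊆ ⋃ i ∈ F, closedBall (c i) (ρ i) := by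
    intro s hs
    obtain ⟨i, hi, his⟩ := h s hs.1 hs.2
    simp only [Set.mem_iUnion, mem_closedBall, Real.dist_eq]
    exact ⟨i, hi, his⟩
  have h1 : volume (Set.Icc 0 D) ≤ ∑ i ∈ F, volume (closedBall (c i) (ρ i)) :=
    (measure_mono hsub).trans (measure_biUnion_finset_le _ _)
  simp only [Real.volume_Icc, sub_zero, Real.volume_closedBall] at h1
  rw [← ENNReal.ofReal_sum_of_nonneg fun i hi => by linarith [hρ i hi]] at h1
  exact (ENNReal.ofReal_le_ofReal_iff
    (Finset.sum_nonneg fun i hi => by linarith [hρ i hi])).1 h1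

/-- Discrete intermediate value property. -/
theorem exists_abs_sub_le_of_steps {u : ℕ → ℝ} {η : ℝ} {a b : ℕ} (hab : a ≤ b)
    (hu : ∀ t, |u (t + 1) - u t| ≤ η) (hη : 0 ≤ η) {s : ℝ} (ha : u a ≤ s) (hb : s ≤ u b) :
    ∃ t, a ≤ t ∧ t ≤ b ∧ |s - u t| ≤ η := by
  induction b, hab using Nat.le_induction with
  | base => exact ⟨a, le_rfl, le_rfl, by rw [show s = u a by linarith]; simpa using hη⟩
  | succ b hab ih =>
    by_cases h : s ≤ u b
    · obtain ⟨t, h1, h2, h3⟩ := ih h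
      exact ⟨t, h1, h2.trans (Nat.le_succ b), h3⟩
    · push Not at h
      refine ⟨b, hab, Nat.le_succ b, ?_⟩
      have := hu b
      rw [abs_le] at this ⊢
      constructor <;> linarith

theorem exists_dist_eq_of_le {Γ : Type*} [MetricSpace Γ] [ConnectedSpace Γ] {y w : Γ} {s : ℝ}
    (hs : 0 ≤ s) (hw : s ≤ dist y w) : ∃ v, dist y v = s := by
  have hc : Continuous fun v => dist y v := continuous_const.dist continuous_id
  have := intermediate_value_univ y w hc
  exact this ⟨by simpa using hs, hw⟩

variable {Γ : Type*} [MetricSpace Γ]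

/-- `IsFork g z R` says that the walk `g` has an arc running almost straight through the ball
`B(z, R)`, from boundary to boundary, and that some point well inside that ball is at distance
at least `R / 4` from the arc. -/
def IsFork (g : ℕ → Γ) (z : Γ) (R : ℝ) : Prop :=
  ∃ (a b : ℕ) (y : Γ), a ≤ b ∧ (∀ t, a ≤ t → t ≤ b → dist (g t) z ≤ 99 / 100 * R) ∧
    49 / 25 * R ≤ dist (g a) (g b) ∧ dist y z ≤ R / 2 ∧
      ∀ t, a ≤ t → t ≤ b → R / 4 ≤ dist y (g t)

/-- A weight on a finite set `U` such that the balls centered at the points of `U`, with the weight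
as diameter, cover the space up to a factor `101 / 100` and with a margin `η`; all weights are at
most `β`. -/
structure IsCoveringWeight (U : Finset Γ) (ω : Γ → ℝ) (η β : ℝ) : Prop where
  nonneg : ∀ p, 0 ≤ ω p
  le : ∀ p, ω p ≤ β
  covers : ∀ w : Γ, ∃ p ∈ U, dist w p + η ≤ 101 / 200 * ω p

variable {U : Finset Γ} {ω : Γ → ℝ} {η β : ℝ} {g : ℕ → Γ}

/-- In a fork ball the arc accounts for almost the weight `2R`, and the connected set leaving the
point far from the arc adds a definite amount. -/
theorem IsFork.le_sum [ConnectedSpace Γ] {z : Γ} {R : ℝ} (h : IsFork g z R)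
    (hω : IsCoveringWeight U ω η β) (hη : 0 ≤ η) (hβ : 64 * β ≤ R) (hR : 0 < R)
    (hg : ∀ t, dist (g t) (g (t + 1)) ≤ η) :
    33 / 16 * R ≤ ∑ p ∈ U.filter fun p => dist p z ≤ R, ω p := by
  classical
  obtain ⟨a, b, y, hab, harc, hlong, hy, hfar⟩ := h
  -- the weights covering the arc, and those covering a neighborhood of the point off the arc
  set P := U.filter fun p => ∃ t, a ≤ t ∧ t ≤ b ∧ dist (g t) p + η ≤ 101 / 200 * ω p with hP
  set P' := U.filter fun p => ∃ v, dist y v ≤ R / 8 ∧ dist v p + η ≤ 101 / 200 * ω p with hP'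
  have hsmall : ∀ p, 101 / 200 * ω p ≤ 1 / 100 * R := by
    intro p
    have h1 := hω.le p
    linarith
  have hdisj : Disjoint P P' := by
    rw [Finset.disjoint_left]
    intro p hp hp'
    obtain ⟨_, t, h1, h2, h3⟩ := Finset.mem_filter.1 hp
    obtain ⟨_, v, h4, h5⟩ := Finset.mem_filter.1 hp'
    have h6 := hfar t h1 h2
    have h7 := dist_triangle4 y v p (g t)
    rw [dist_comm p (g t)] at h7
    linarith [hsmall p]
  have hsub : P ∪ P' ⊆ U.filter fun p => dist p z ≤ R := by
    intro p hp
    rw [Finset.mem_filter]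
    rcases Finset.mem_union.1 hp with hp | hp
    · obtain ⟨hpU, t, h1, h2, h3⟩ := Finset.mem_filter.1 hp
      refine ⟨hpU, ?_⟩
      have h4 := dist_triangle_left p z (g t)
      linarith [harc t h1 h2, hsmall p]
    · obtain ⟨hpU, v, h4, h5⟩ := Finset.mem_filter.1 hp
      refine ⟨hpU, ?_⟩
      have h7 := dist_triangle4 p v y z
      rw [dist_comm p v, dist_comm v y] at h7
      linarith [hsmall p]
  have h1 : dist (g a) (g b) ≤ ∑ p ∈ P, 2 * (101 / 200 * ω p) := by
    refine le_sum_of_Icc_cover P (fun p => dist (g a) p) _ (fun p _ => ?_) ?_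
    · linarith [hω.nonneg p]
    · intro s hs0 hs
      obtain ⟨t, hat, htb, hts⟩ := exists_abs_sub_le_of_steps (u := fun t => dist (g a) (g t))
        (s := s) hab (fun t => by
          have h1 := dist_triangle (g a) (g t) (g (t + 1))
          have h2 := dist_triangle_right (g a) (g t) (g (t + 1))
          rw [abs_le]
          constructor <;> linarith [hg t]) hη (by simpa using hs0) hs
      obtain ⟨p, hp, hpt⟩ := hω.covers (g t)
      refine ⟨p, Finset.mem_filter.2 ⟨hp, t, hat, htb, hpt⟩, ?_⟩
      have h1 := dist_triangle (g a) (g t) p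
      have h2 := dist_triangle_right (g a) (g t) p
      rw [abs_le] at hts ⊢
      constructor <;> linarith
  have h2 : R / 8 ≤ ∑ p ∈ P', 2 * (101 / 200 * ω p) := by
    refine le_sum_of_Icc_cover P' (fun p => dist y p) _ (fun p _ => ?_) ?_
    · linarith [hω.nonneg p]
    · intro s hs0 hs
      obtain ⟨v, hv⟩ := exists_dist_eq_of_le (y := y) (w := g a) hs0
        (by linarith [hfar a le_rfl hab])
      obtain ⟨p, hp, hpt⟩ := hω.covers v
      refine ⟨p, Finset.mem_filter.2 ⟨hp, v, by linarith, hpt⟩, ?_⟩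
      have h1 := dist_triangle y v p
      have h2 := dist_triangle_right y v p
      rw [abs_le]
      constructor <;> linarith
  have h3 : ∑ p ∈ P, ω p + ∑ p ∈ P', ω p ≤ ∑ p ∈ U.filter fun p => dist p z ≤ R, ω p := by
    rw [← Finset.sum_union hdisj]
    exact Finset.sum_le_sum_of_subset_of_nonneg hsub fun p _ _ => hω.nonneg p
  rw [← Finset.mul_sum, ← Finset.mul_sum] at h1 h2
  linarith

/-- Collapsing the weight inside separated balls `B(z, R)` to weight `2R` at the centers. -/
theorem IsCoveringWeight.collapse (hω : IsCoveringWeight U ω η β) {Z : Finset Γ}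
    (hZU : Z ⊆ U) {R : ℝ} (hR : 0 ≤ R) (hβ : 64 * β ≤ R) {c : ℝ}
    (hsep : ∀ x ∈ Z, ∀ y ∈ Z, x ≠ y → 2 * R < dist x y)
    (hmass : ∀ z ∈ Z, 2 * R + c ≤ ∑ p ∈ U.filter fun p => dist p z ≤ R, ω p) :
    ∃ ω', IsCoveringWeight U ω' η (2 * R) ∧
      ∑ p ∈ U, ω' p + Z.card * c ≤ ∑ p ∈ U, ω p := by
  classical
  set E := Z.biUnion fun z => U.filter fun p => dist p z ≤ R with hE
  have hEU : E ⊆ U := by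
    intro p hp
    obtain ⟨z, _, hz⟩ := Finset.mem_biUnion.1 hp
    exact (Finset.mem_filter.1 hz).1
  have hZE : Z ⊆ E := fun z hz =>
    Finset.mem_biUnion.2 ⟨z, hz, Finset.mem_filter.2 ⟨hZU hz, by simpa using hR⟩⟩
  have hβ' : ∀ p, ω p ≤ 1 / 64 * R := fun p => by linarith [hω.le p]
  refine ⟨fun p => if p ∈ Z then 2 * R else if p ∈ E then 0 else ω p, ⟨?_, ?_, ?_⟩, ?_⟩
  · intro p
    split_ifs
    · linarith
    · exact le_rfl
    · exact hω.nonneg p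
  · intro p
    split_ifs
    · exact le_rfl
    · linarith
    · linarith [hβ' p]
  · intro w
    obtain ⟨p, hp, hwp⟩ := hω.covers w
    by_cases hpE : p ∈ E
    · obtain ⟨z, hz, hpz⟩ := Finset.mem_biUnion.1 hpE
      refine ⟨z, hZU hz, ?_⟩
      rw [if_pos hz]
      have h1 := (Finset.mem_filter.1 hpz).2
      have h2 := dist_triangle w p z
      linarith [hβ' p]
    · refine ⟨p, hp, ?_⟩
      rw [if_neg fun h => hpE (hZE h), if_neg hpE]
      exact hwp
  · have hsum : ∑ p ∈ U, ω p = ∑ p ∈ E, ω p + ∑ p ∈ U \ E, ω p := by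
      rw [add_comm]; exact (Finset.sum_sdiff hEU).symm
    have hE' : ∑ p ∈ E, ω p = ∑ z ∈ Z, ∑ p ∈ U.filter fun p => dist p z ≤ R, ω p := by
      refine Finset.sum_biUnion ?_
      intro x hx y hy hne
      rw [Function.onFun, Finset.disjoint_left]
      intro p hp hp'
      have h1 := (Finset.mem_filter.1 hp).2
      have h2 := (Finset.mem_filter.1 hp').2
      have h3 := dist_triangle_left x y p
      linarith [hsep x hx y hy hne]
    have hE'' : Z.card * (2 * R + c) ≤ ∑ p ∈ E, ω p := by
      rw [hE', ← nsmul_eq_mul]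
      exact Finset.card_nsmul_le_sum _ _ _ hmass
    have hnew : ∑ p ∈ U, (if p ∈ Z then 2 * R else if p ∈ E then 0 else ω p) =
        Z.card * (2 * R) + ∑ p ∈ U \ E, ω p := by
      rw [← Finset.sum_sdiff hEU, add_comm]
      congr 1
      · rw [← Finset.sum_sdiff hZE]
        rw [Finset.sum_eq_zero, zero_add, Finset.sum_congr rfl fun p hp => if_pos hp,
          Finset.sum_const, nsmul_eq_mul]
        intro p hp
        rw [if_neg (Finset.mem_sdiff.1 hp).2, if_pos (Finset.mem_sdiff.1 hp).1]
      · refine Finset.sum_congr rfl fun p hp => ?_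
        have h1 := (Finset.mem_sdiff.1 hp).2
        rw [if_neg fun h => h1 (hZE h), if_neg h1]
    rw [hnew, hsum]
    linarith

/-- Fork balls at sparse scales, indexed from the finest to the coarsest and separated at each
scale, have a total radius bounded by the total mass. -/
theorem sum_isFork_le [ConnectedSpace Γ] (hg : ∀ t, dist (g t) (g (t + 1)) ≤ η) (hη : 0 ≤ η)
    {R : ℕ → ℝ} (hR : ∀ l, 0 < R l) (hRs : ∀ l, 128 * R l ≤ R (l + 1)) {Z : ℕ → Finset Γ}
    (hZU : ∀ l, Z l ⊆ U) (hω : IsCoveringWeight U ω η β) (hβ : 64 * β ≤ R 0)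
    (hsep : ∀ l, ∀ x ∈ Z l, ∀ y ∈ Z l, x ≠ y → 2 * R l < dist x y)
    (hfork : ∀ l, ∀ z ∈ Z l, IsFork g z (R l)) (L : ℕ) :
    ∑ l ∈ Finset.range L, (Z l).card * (R l / 16) ≤ ∑ p ∈ U, ω p := by
  suffices h : ∃ ω' β', IsCoveringWeight U ω' η β' ∧ 64 * β' ≤ R L ∧
      ∑ p ∈ U, ω' p + ∑ l ∈ Finset.range L, (Z l).card * (R l / 16) ≤ ∑ p ∈ U, ω p by
    obtain ⟨ω', β', hω', _, h⟩ := h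
    linarith [Finset.sum_nonneg fun p (_ : p ∈ U) => hω'.nonneg p]
  induction L with
  | zero => exact ⟨ω, β, hω, hβ, by simp⟩
  | succ L ih =>
    obtain ⟨ω', β', hω', hβ', hle⟩ := ih
    obtain ⟨ω'', hω'', hle'⟩ := hω'.collapse (hZU L) (hR L).le hβ' (c := R L / 16) (hsep L)
      fun z hz => by
        have := (hfork L z hz).le_sum hω' hη hβ' (hR L) hg
        linarith
    refine ⟨ω'', 2 * R L, hω'', by linarith [hRs L], ?_⟩
    rw [Finset.sum_range_succ]
    linarith

end Fork

/-! ### Bent balls and forks -/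

section Dichotomy

variable {Γ : Type*} [MetricSpace Γ]

/-- If the walk leaves the ball `B(z, ρ)` after time `t`, it has a stretch from time `t` on inside
that ball that ends within one step of the boundary. -/
theorem exists_forward_stretch {g : ℕ → Γ} {η ρ : ℝ} (hg : ∀ t, dist (g t) (g (t + 1)) ≤ η)
    {z : Γ} {t T : ℕ} (ht : dist (g t) z ≤ ρ) (htT : t ≤ T) (hT : ρ < dist (g T) z) :
    ∃ b, t ≤ b ∧ b < T ∧ (∀ s, t ≤ s → s ≤ b → dist (g s) z ≤ ρ) ∧ ρ - η < dist (g b) z := by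
  induction T, htT using Nat.le_induction with
  | base => exact absurd hT (not_lt.2 ht)
  | succ T htT ih =>
    by_cases h : ρ < dist (g T) z
    · obtain ⟨b, h1, h2, h3⟩ := ih h
      exact ⟨b, h1, h2.trans (Nat.lt_succ_self T), h3⟩
    · by_cases hall : ∀ s, t ≤ s → s ≤ T → dist (g s) z ≤ ρ
      · refine ⟨T, htT, Nat.lt_succ_self T, hall, ?_⟩
        have h1 := dist_triangle_left (g (T + 1)) z (g T)
        linarith [hg T]
      · -- the first exit from the ball happens before time `T`
        classical
        push Not at hall
        have hex : ∃ s, t ≤ s ∧ s ≤ T ∧ ρ < dist (g s) z := hall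
        obtain ⟨h1, h2, h3⟩ := Nat.find_spec hex
        have hmin : ∀ s, t ≤ s → s < Nat.find hex → dist (g s) z ≤ ρ := by
          intro s hs1 hs2
          by_contra hcon
          exact Nat.find_min hex hs2 ⟨hs1, by omega, not_le.1 hcon⟩
        have hlt : t < Nat.find hex := by
          rcases h1.eq_or_lt with h | h
          · rw [← h] at h3
            exact absurd h3 (not_lt.2 ht)
          · exact h
        obtain ⟨b, hb⟩ : ∃ b, Nat.find hex = b + 1 := ⟨Nat.find hex - 1, by omega⟩
        rw [hb] at h3 hlt h2 hmin
        refine ⟨b, by omega, by omega, fun s hs1 hs2 => hmin s hs1 (by omega), ?_⟩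
        have h4 := dist_triangle_left (g (b + 1)) z (g b)
        linarith [hg b]

theorem exists_backward_stretch {g : ℕ → Γ} {η ρ : ℝ} (hg : ∀ t, dist (g t) (g (t + 1)) ≤ η)
    {z : Γ} {t T : ℕ} (ht : dist (g t) z ≤ ρ) (hTt : T ≤ t) (hT : ρ < dist (g T) z) :
    ∃ a, T < a ∧ a ≤ t ∧ (∀ s, a ≤ s → s ≤ t → dist (g s) z ≤ ρ) ∧ ρ - η < dist (g a) z := by
  have hη : 0 ≤ η := dist_nonneg.trans (hg 0)
  obtain ⟨b, h1, h2, h3, h4⟩ := exists_forward_stretch (g := fun s => g (t - s)) (η := η)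
    (ρ := ρ) (fun s => by
      rcases Nat.lt_or_ge s t with h | h
      · obtain ⟨k, hk⟩ : ∃ k, t = s + 1 + k := ⟨t - (s + 1), by omega⟩
        rw [show t - s = k + 1 by omega, show t - (s + 1) = k by omega, dist_comm]
        exact hg k
      · rw [show t - s = 0 by omega, show t - (s + 1) = 0 by omega, dist_self]
        exact hη) (z := z) (t := 0) (T := t - T) (by simpa using ht) (Nat.zero_le _)
    (by simpa [Nat.sub_sub_self hTt] using hT)
  refine ⟨t - b, by omega, by omega, fun s hs1 hs2 => ?_, h4⟩
  have := h3 (t - s) (Nat.zero_le _) (by omega)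
  rwa [Nat.sub_sub_self hs2] at this

/-- Let `g` be a periodic walk with period `n`, dense at scale `η`, followed over three periods.
A ball containing a triple of defect more than `εr` is either bent, or close to it there is
a fork at a scale between `εr` and `r`: if the arc of the walk through the center is almost straight,
some point of the triple is off the arc, and the fork is found where it is closest to the arc. -/
theorem isBent_or_exists_isFork {g : ℕ → Γ} {n : ℕ} {η : ℝ}
    (hg : ∀ t, dist (g t) (g (t + 1)) ≤ η) (hper : ∀ t, g (t + n) = g t)
    (hdense : ∀ w, ∃ t, n ≤ t ∧ t < 2 * n ∧ dist w (g t) ≤ η)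
    {x : Γ} (hx : ∃ t, x = g t ∧ n ≤ t ∧ t < 2 * n)
    {r ε : ℝ} (hr : 0 < r) (hε : 0 < ε) (hη : 1000 * η ≤ ε * r)
    (hbad : ∃ y₁ y₂ y₃, dist y₁ x ≤ r ∧ dist y₂ x ≤ r ∧ dist y₃ x ≤ r ∧
      ε * r < defect y₁ y₂ y₃) :
    IsBent g (3 * n) x r (ε * r / 1000) ∨
      ∃ (j : ℤ) (z : Γ), (∃ t, z = g t) ∧ IsFork g z (2 ^ j) ∧ dist z x ≤ 2 * r ∧
        ε * r ≤ 5 * 2 ^ j ∧ (2 : ℝ) ^ j ≤ 4 * r := by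
  classical
  rw [or_iff_not_imp_left]
  intro hbent
  have hflat : ∀ a c b, a ≤ c → c ≤ b → b ≤ 3 * n →
      (∀ t, a ≤ t → t ≤ b → dist (g t) x ≤ 6 * r) →
      orderedDefect (g a) (g c) (g b) ≤ ε * r / 1000 := by
    intro a c b h1 h2 h3 h4
    by_contra hcon
    exact hbent ⟨a, c, b, h1, h2, h3, h4, (not_le.1 hcon).le⟩
  obtain ⟨t₀, hxt, ht₀, ht₀'⟩ := hx
  obtain ⟨y₁, y₂, y₃, hy₁, hy₂, hy₃, hdef⟩ := hbad
  have hη0 : 0 ≤ η := dist_nonneg.trans (hg 0)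
  have hεr : 0 < ε * r := by positivity
  -- the walk leaves `B(x, 6r)` during each period
  obtain ⟨u, hu1, hu2, hu⟩ : ∃ u, t₀ ≤ u ∧ u ≤ t₀ + n ∧ 6 * r < dist (g u) x := by
    by_contra hcon
    push Not at hcon
    have hsmall : ∀ w, dist w x ≤ ε * r / 400 := by
      intro w
      obtain ⟨t, h1, h2, h3⟩ := hdense w
      obtain ⟨s, hs1, hs2, hs⟩ : ∃ s, t₀ ≤ s ∧ s ≤ t₀ + n ∧ g s = g t := by
        rcases le_total t₀ t with h | h
        · exact ⟨t, h, by omega, rfl⟩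
        · exact ⟨t + n, by omega, by omega, hper t⟩
      have h4 := hflat t₀ s (t₀ + n) hs1 hs2 (by omega) hcon
      rw [hper, hs, ← hxt, orderedDefect, dist_self, dist_comm x] at h4
      have h5 := dist_triangle w (g t) x
      linarith
    have h1 := defect_le_dist y₁ y₂ y₃
    have h2 := dist_triangle_right y₁ y₂ x
    linarith [hsmall y₁, hsmall y₂]
  have hu' : 6 * r < dist (g (u - n)) x := by
    rw [← hper (u - n), Nat.sub_add_cancel (by omega)]
    exact hu
  have hx0 : dist (g t₀) x ≤ 6 * r := by rw [← hxt, dist_self]; positivity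
  -- the arc of the walk through `x` inside `B(x, 6r)`
  obtain ⟨b, htb, hbu, hb, hb'⟩ := exists_forward_stretch hg hx0 hu1 hu
  obtain ⟨a, hua, hat, ha, ha'⟩ := exists_backward_stretch hg hx0 (show u - n ≤ t₀ by omega) hu'
  have hab : ∀ t, a ≤ t → t ≤ b → dist (g t) x ≤ 6 * r := by
    intro t h1 h2
    rcases le_total t t₀ with h | h
    · exact ha t h1 h
    · exact hb t h h2
  have hflat' : ∀ t₁ t₂ t₃, a ≤ t₁ → t₁ ≤ t₂ → t₂ ≤ t₃ → t₃ ≤ b →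
      orderedDefect (g t₁) (g t₂) (g t₃) ≤ ε * r / 1000 := fun t₁ t₂ t₃ h1 h2 h3 h4 =>
    hflat t₁ t₂ t₃ h2 h3 (by omega) fun t h5 h6 => hab t (by omega) (by omega)
  -- a point of the triple that is far from the arc
  obtain ⟨y, hyx, hyfar⟩ : ∃ y, dist y x ≤ r ∧ ∀ t, a ≤ t → t ≤ b → ε * r / 10 < dist y (g t) := by
    by_contra hcon
    push Not at hcon
    have := defect_le_of_path hflat' (hcon y₁ hy₁) (hcon y₂ hy₂) (hcon y₃ hy₃)
    linarith
  obtain ⟨t', ht', hmin⟩ := Finset.exists_min_image (Finset.Icc a b) (fun t => dist y (g t))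
    ⟨t₀, Finset.mem_Icc.2 ⟨hat, htb⟩⟩
  rw [Finset.mem_Icc] at ht'
  have hδ := hyfar t' ht'.1 ht'.2
  set δ := dist y (g t') with hδdef
  have hδr : δ ≤ r := by
    have := hmin t₀ (Finset.mem_Icc.2 ⟨hat, htb⟩)
    rw [← hxt] at this
    exact this.trans hyx
  -- the fork has radius `R = 2 ^ j` with `2δ ≤ R < 4δ`
  obtain ⟨j, hj1, hj2⟩ := exists_mem_Ioc_zpow (x := 4 * δ) (y := (2 : ℝ)) (by linarith)
    (by norm_num)
  rw [zpow_add_one₀ (by norm_num)] at hj2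
  set R : ℝ := 2 ^ j with hR
  have hR0 : 0 < R := by positivity
  have hzx : dist (g t') x ≤ 2 * r := by
    have := dist_triangle_left (g t') x y
    linarith
  refine ⟨j, g t', ⟨t', rfl⟩, ?_, hzx, by linarith, by linarith⟩
  have hz0 : dist (g t') (g t') ≤ 99 / 100 * R := by rw [dist_self]; positivity
  have hbz : 99 / 100 * R < dist (g b) (g t') := by
    have h1 := dist_triangle (g b) (g t') x
    linarith
  have haz : 99 / 100 * R < dist (g a) (g t') := by
    have h1 := dist_triangle (g a) (g t') x
    linarith
  obtain ⟨b', h1, h2, h3, h4⟩ := exists_forward_stretch hg hz0 ht'.2 hbz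
  obtain ⟨a', h5, h6, h7, h8⟩ := exists_backward_stretch hg hz0 ht'.1 haz
  refine ⟨a', b', y, by omega, ?_, ?_, by linarith, ?_⟩
  · intro t h9 h10
    rcases le_total t t' with h | h
    · exact h7 t h9 h
    · exact h3 t h h10
  · have h9 := hflat' a' t' b' h5.le h6 h1 h2.le
    rw [orderedDefect, dist_comm (g t')] at h9
    linarith
  · intro t h9 h10
    have := hmin t (Finset.mem_Icc.2 ⟨by omega, by omega⟩)
    linarith

end Dichotomy

/-! ### Summing the radii of bent balls and of balls near forks -/

section Sums

variable {Γ : Type*} [MetricSpace Γ] {X : ℤ → Set Γ} {A : ℝ} {M : ℕ} {g : ℕ → Γ}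

theorem sum_le_sum_sum_filter {ι κ : Type*} (S : Finset ι) (Z : Finset κ) {f : ι → ℝ}
    (hf : ∀ B, 0 ≤ f B) {P : ι → κ → Prop} [∀ y, DecidablePred fun B => P B y]
    (h : ∀ B ∈ S, ∃ y ∈ Z, P B y) :
    ∑ B ∈ S, f B ≤ ∑ y ∈ Z, ∑ B ∈ S.filter (fun B => P B y), f B := by
  simp_rw [Finset.sum_filter]
  rw [Finset.sum_comm]
  refine Finset.sum_le_sum fun B hB => ?_
  obtain ⟨y, hy, hBy⟩ := h B hB
  have h1 : ∀ y ∈ Z, 0 ≤ if P B y then f B else 0 := by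
    intro y _
    split_ifs
    · exact hf B
    · exact le_rfl
  exact (if_pos hBy).symm.trans_le (Finset.single_le_sum h1 hy)

/-- At most `M` points of each net lie in a ball of `14` times the radius of the balls of the
multiresolution family at the scale of the net. -/
def FewNetPoints (X : ℤ → Set Γ) (A : ℝ) (M : ℕ) : Prop :=
  ∀ (n : ℤ) (y : Γ) (F : Finset Γ), (∀ x ∈ F, x ∈ X n) →
    (∀ x ∈ F, dist x y ≤ 14 * (A * (2 : ℝ) ^ (-n))) → F.card ≤ M

theorem IsNestedNets.fewNetPoints {N : ℕ} (hΓ : IsDoublingWith Γ N) (hX : IsNestedNets X) {k : ℕ}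
    (hk : 28 * A ≤ 2 ^ k) : FewNetPoints X A (N ^ k) := by
  intro n y F hF hFy
  have h2 : (0 : ℝ) < 2 ^ (-n) := by positivity
  refine hΓ.card_le h2 k y F (fun x hx z hz hne => ?_) fun x hx => (hFy x hx).trans ?_
  · exact (hX.isEpsNet n).separated x (hF x hx) z (hF z hz) hne
  · nlinarith

/-- The sum of the radii of the bent balls; the factor `i + 18` is the number of scales between two
successive scales in the argument with sparse scales. -/
theorem sum_radius_bent_le (hA : 0 < A) (hM : FewNetPoints X A M) {T : ℕ} (i : ℕ)
    (S : Finset (ℤ × Γ)) (hSX : ∀ B ∈ S, B.2 ∈ X B.1)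
    (hS : ∀ B ∈ S, IsBent g T B.2 (A * (2 : ℝ) ^ (-B.1))
      ((1 / 2) ^ i * (A * (2 : ℝ) ^ (-B.1)) / 1000)) :
    ∑ B ∈ S, A * (2 : ℝ) ^ (-B.1) ≤ (i + 18) * (M * (2000 * 2 ^ i * walkLength T g)) := by
  classical
  have hwl := walkLength_nonneg T g
  rcases S.eq_empty_or_nonempty with rfl | hne
  · rw [Finset.sum_empty]; positivity
  obtain ⟨q, hq⟩ : ∃ q : ℤ, ∀ B ∈ S, B.1 ≤ q :=
    ⟨(S.image Prod.fst).max' (hne.image _), fun B hB =>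
      Finset.le_max' _ _ (Finset.mem_image_of_mem _ hB)⟩
  set ρ : ℕ → ℝ := fun k => A * (2 : ℝ) ^ (-q) * 2 ^ k with hρ
  have hρ0 : ∀ k, 0 < ρ k := fun k => by positivity
  set S' : ℕ → Finset (ℤ × Γ) := fun k => S.filter fun B => (q - B.1).toNat = k with hS'
  have hrad : ∀ k, ∀ B ∈ S' k, A * (2 : ℝ) ^ (-B.1) = ρ k := by
    intro k B hB
    obtain ⟨hB, hBk⟩ := Finset.mem_filter.1 hB
    have h1 := hq B hB
    have h2 : -B.1 = -q + (k : ℤ) := by omega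
    rw [h2, zpow_add₀ (by norm_num), zpow_natCast, ← mul_assoc]
  set G : ℕ → Finset Γ := fun k => (S' k).image Prod.snd with hG
  choose G' hG'sub hG'sep hG'den using fun k =>
    exists_separated_subset (D := 12 * ρ k) (by linarith [hρ0 k]) (G k)
  have hcard : ∀ k, ((S' k).card : ℝ) ≤ M * (G' k).card := by
    intro k
    have hinj : Set.InjOn Prod.snd (S' k : Set (ℤ × Γ)) := by
      intro B hB B' hB' h
      obtain ⟨hB, hBk⟩ := Finset.mem_filter.1 hB
      obtain ⟨hB', hBk'⟩ := Finset.mem_filter.1 hB'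
      have h1 := hq B hB
      have h2 := hq B' hB'
      exact Prod.ext (by omega) h
    have h1 : (G k).card ≤ (G' k).card * M := by
      refine (Finset.card_le_card (t := (G' k).biUnion fun y =>
        (G k).filter fun x => dist x y ≤ 12 * ρ k) ?_).trans
        (Finset.card_biUnion_le_card_mul _ _ _ ?_)
      · intro x hx
        obtain ⟨y, hy, hxy⟩ := hG'den k x hx
        exact Finset.mem_biUnion.2 ⟨y, hy, Finset.mem_filter.2 ⟨hx, hxy⟩⟩
      · intro y hy
        obtain ⟨B, hB, _⟩ := Finset.mem_image.1 (hG'sub k hy)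
        refine hM B.1 y _ (fun x hx => ?_) fun x hx => ?_
        · obtain ⟨B', hB', rfl⟩ := Finset.mem_image.1 (Finset.mem_filter.1 hx).1
          have h3 := hSX B' (Finset.mem_filter.1 hB').1
          have h4 := hq B (Finset.mem_filter.1 hB).1
          have h5 := hq B' (Finset.mem_filter.1 hB').1
          have h6 := (Finset.mem_filter.1 hB).2
          have h7 := (Finset.mem_filter.1 hB').2
          rwa [show B.1 = B'.1 by omega]
        · rw [hrad k B hB]
          linarith [(Finset.mem_filter.1 hx).2, hρ0 k]
    rw [← Finset.card_image_of_injOn hinj, mul_comm]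
    exact_mod_cast h1
  have hlevels : ∑ B ∈ S, A * (2 : ℝ) ^ (-B.1) ≤
      ∑ k ∈ Finset.range (S.sup (fun B => (q - B.1).toNat) + 1), M * ((G' k).card * ρ k) := by
    rw [← Finset.sum_fiberwise_of_maps_to (s := S)
      (t := Finset.range (S.sup (fun B => (q - B.1).toNat) + 1))
      (g := fun B => (q - B.1).toNat) (fun B hB =>
        Finset.mem_range.2 (Nat.lt_succ_of_le (Finset.le_sup (f := fun B => (q - B.1).toNat) hB)))]
    refine Finset.sum_le_sum fun k _ => ?_
    rw [Finset.sum_congr rfl (hrad k), Finset.sum_const, nsmul_eq_mul,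
      ← mul_assoc (M : ℝ)]
    exact mul_le_mul_of_nonneg_right (hcard k) (hρ0 k).le
  refine hlevels.trans ?_
  have hprog := sum_range_le_of_progressions (F := fun k => M * ((G' k).card * ρ k))
    (m := i + 18) (W := M * (2000 * 2 ^ i * walkLength T g))
    (fun k => by have := hρ0 k; positivity) (by omega) ?_
    (S.sup (fun B => (q - B.1).toNat) + 1)
  · simpa using hprog
  intro c L
  rw [← Finset.mul_sum]
  refine mul_le_mul_of_nonneg_left ?_ (Nat.cast_nonneg M)
  have hstep : ∀ l, ρ (c + (i + 18) * (l + 1)) = 2 ^ (i + 18) * ρ (c + (i + 18) * l) := by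
    intro l
    simp only [hρ]
    ring
  have h2i : (1 : ℝ) ≤ 2 ^ i := one_le_pow₀ (by norm_num)
  have key := sum_isBent_le (g := g) (T := T) (S := fun l => G' (c + (i + 18) * l))
    (r := fun l => ρ (c + (i + 18) * l))
    (e := fun l => (1 / 2) ^ i * ρ (c + (i + 18) * l) / 1000)
    (D := fun l => 13 * (1 / 2) ^ (i + 18) * ρ (c + (i + 18) * l))
    (fun l => (hρ0 _).le) (by have := hρ0 (c + (i + 18) * 0); positivity)
    (fun l => ?_) (fun l => ?_) (fun l => hG'sep _) (fun l x hx => ?_) L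
  · have h1 : ∑ l ∈ Finset.range L, ((G' (c + (i + 18) * l)).card : ℝ) * ρ (c + (i + 18) * l) =
        2000 * 2 ^ i * ∑ l ∈ Finset.range L, ((G' (c + (i + 18) * l)).card : ℝ) *
          ((1 / 2) ^ i * ρ (c + (i + 18) * l) / 1000 / 2) := by
      rw [Finset.mul_sum]
      refine Finset.sum_congr rfl fun l _ => ?_
      have h2 : (1 / 2 : ℝ) ^ i * 2 ^ i = 1 := by rw [← mul_pow]; norm_num
      linear_combination (-((G' (c + (i + 18) * l)).card : ℝ) * ρ (c + (i + 18) * l)) * h2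
    rw [h1]
    exact mul_le_mul_of_nonneg_left key (by positivity)
  · have h0 := hρ0 (c + (i + 18) * l)
    have h1 : (1 / 2 : ℝ) ^ (i + 18) * 2 ^ (i + 18) = 1 := by rw [← mul_pow]; norm_num
    have h2 : (1 / 2 : ℝ) ^ (i + 18) ≤ 1 / 13 := by
      calc (1 / 2 : ℝ) ^ (i + 18) ≤ (1 / 2) ^ 18 :=
            pow_le_pow_of_le_one (by norm_num) (by norm_num) (by omega)
        _ ≤ 1 / 13 := by norm_num
    rw [hstep, show 13 * (1 / 2 : ℝ) ^ (i + 18) * (2 ^ (i + 18) * ρ (c + (i + 18) * l)) =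
      13 * ((1 / 2 : ℝ) ^ (i + 18) * 2 ^ (i + 18)) * ρ (c + (i + 18) * l) by ring, h1]
    nlinarith
  · have h0 := hρ0 (c + (i + 18) * l)
    have h1 : (0 : ℝ) < (1 / 2) ^ i := by positivity
    rw [pow_add]
    have h2 : 0 < (1 / 2 : ℝ) ^ i * ρ (c + (i + 18) * l) := by positivity
    norm_num at h2 ⊢
    nlinarith
  · obtain ⟨B, hB, rfl⟩ := Finset.mem_image.1 (hG'sub _ hx)
    have h1 := hS B (Finset.mem_filter.1 hB).1
    rwa [hrad _ B hB] at h1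

/-- The sum of the radii of the balls having a fork nearby, at a scale larger than `2⁻ⁱ` times
the radius: each fork ball is charged a geometric sum over the scales. -/
theorem sum_radius_fork_le [ConnectedSpace Γ] (hA : 0 < A) (hM : FewNetPoints X A M)
    {η β : ℝ} (hg : ∀ t, dist (g t) (g (t + 1)) ≤ η) {U : Finset Γ} (hU : ∀ t, g t ∈ U)
    {ω : Γ → ℝ} (hω : IsCoveringWeight U ω η β) (i : ℕ)
    (S : Finset (ℤ × Γ)) (hSX : ∀ B ∈ S, B.2 ∈ X B.1)
    (hβ : ∀ B ∈ S, 320 * β ≤ (1 / 2) ^ i * (A * (2 : ℝ) ^ (-B.1)))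
    (hS : ∀ B ∈ S, ∃ (j : ℤ) (z : Γ), (∃ t, z = g t) ∧ IsFork g z (2 ^ j) ∧
      dist z B.2 ≤ 2 * (A * (2 : ℝ) ^ (-B.1)) ∧
        (1 / 2) ^ i * (A * (2 : ℝ) ^ (-B.1)) ≤ 5 * 2 ^ j ∧
          (2 : ℝ) ^ j ≤ 4 * (A * (2 : ℝ) ^ (-B.1))) :
    ∑ B ∈ S, A * (2 : ℝ) ^ (-B.1) ≤ 1120 * M * 2 ^ i * ∑ p ∈ U, ω p := by
  classical
  have hη : 0 ≤ η := dist_nonneg.trans (hg 0)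
  have hωsum : 0 ≤ ∑ p ∈ U, ω p := Finset.sum_nonneg fun p _ => hω.nonneg p
  rcases S.eq_empty_or_nonempty with rfl | hne
  · rw [Finset.sum_empty]; positivity
  choose! j z hzg hfork hzx hlow hup using hS
  obtain ⟨B₀, hB₀, hq⟩ : ∃ B₀ ∈ S, ∀ B ∈ S, j B₀ ≤ j B := Finset.exists_min_image S j hne
  set q := j B₀
  set R : ℕ → ℝ := fun k => (2 : ℝ) ^ q * 2 ^ k with hR
  have hR0 : ∀ k, 0 < R k := fun k => by positivity
  set S' : ℕ → Finset (ℤ × Γ) := fun k => S.filter fun B => (j B - q).toNat = k with hS'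
  have hrad : ∀ k, ∀ B ∈ S' k, (2 : ℝ) ^ (j B) = R k := by
    intro k B hB
    obtain ⟨hB, hBk⟩ := Finset.mem_filter.1 hB
    have h1 := hq B hB
    have h2 : j B = q + (k : ℤ) := by omega
    rw [h2, zpow_add₀ (by norm_num), zpow_natCast]
  choose Z hZsub hZsep hZden using fun k =>
    exists_separated_subset (D := 2 * R k) (by linarith [hR0 k]) ((S' k).image z)
  -- the balls charged to one fork
  have hcharge : ∀ k, ∀ y : Γ, ∑ B ∈ (S' k).filter (fun B => dist (z B) y ≤ 2 * R k),
      A * (2 : ℝ) ^ (-B.1) ≤ M * (2 * (5 * 2 ^ i * R k)) := by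
    intro k y
    set F := (S' k).filter fun B => dist (z B) y ≤ 2 * R k with hF
    have hFS : ∀ B ∈ F, B ∈ S := fun B hB =>
      (Finset.mem_filter.1 (Finset.mem_filter.1 hB).1).1
    have h1 : ∑ B ∈ F, A * (2 : ℝ) ^ (-B.1) =
        ∑ n ∈ F.image Prod.fst, ∑ B ∈ F.filter (fun B => B.1 = n), A * (2 : ℝ) ^ (-B.1) :=
      (Finset.sum_fiberwise_of_maps_to (fun B hB => Finset.mem_image_of_mem _ hB) _).symm
    have h2 : ∀ n ∈ F.image Prod.fst,
        ∑ B ∈ F.filter (fun B => B.1 = n), A * (2 : ℝ) ^ (-B.1) ≤ M * (A * (2 : ℝ) ^ (-n)) := by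
      intro n _
      have h3 : ∀ B ∈ F.filter (fun B => B.1 = n), A * (2 : ℝ) ^ (-B.1) = A * (2 : ℝ) ^ (-n) := by
        intro B hB
        rw [(Finset.mem_filter.1 hB).2]
      rw [Finset.sum_congr rfl h3, Finset.sum_const, nsmul_eq_mul]
      refine mul_le_mul_of_nonneg_right ?_ (by positivity)
      have hinj : Set.InjOn Prod.snd (F.filter (fun B => B.1 = n) : Set (ℤ × Γ)) := by
        intro B hB B' hB' h
        exact Prod.ext ((Finset.mem_filter.1 hB).2.trans (Finset.mem_filter.1 hB').2.symm) h
      rw [← Finset.card_image_of_injOn hinj]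
      refine Nat.cast_le.2 (hM n y _ (fun x hx => ?_) fun x hx => ?_)
      · obtain ⟨B, hB, rfl⟩ := Finset.mem_image.1 hx
        obtain ⟨hBF, rfl⟩ := Finset.mem_filter.1 hB
        exact hSX B (hFS B hBF)
      · obtain ⟨B, hB, rfl⟩ := Finset.mem_image.1 hx
        obtain ⟨hBF, rfl⟩ := Finset.mem_filter.1 hB
        have h4 := hzx B (hFS B hBF)
        have h5 := hup B (hFS B hBF)
        have h6 := (Finset.mem_filter.1 hBF).2
        rw [hrad k B (Finset.mem_filter.1 hBF).1] at h5
        have h7 := dist_triangle_left B.2 y (z B)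
        have h8 : 0 < A * (2 : ℝ) ^ (-B.1) := by positivity
        linarith
    calc ∑ B ∈ F, A * (2 : ℝ) ^ (-B.1) ≤ ∑ n ∈ F.image Prod.fst, M * (A * (2 : ℝ) ^ (-n)) :=
          h1.trans_le (Finset.sum_le_sum h2)
      _ = M * ∑ n ∈ F.image Prod.fst, A * (2 : ℝ) ^ (-n) := by rw [Finset.mul_sum]
      _ ≤ M * (2 * (5 * 2 ^ i * R k)) := by
        refine mul_le_mul_of_nonneg_left (sum_zpow_le _ hA.le (by have := hR0 k; positivity) ?_)
          (Nat.cast_nonneg M)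
        intro n hn
        obtain ⟨B, hB, rfl⟩ := Finset.mem_image.1 hn
        have h4 := hlow B (hFS B hB)
        rw [hrad k B (Finset.mem_filter.1 hB).1] at h4
        have h5 : (1 / 2 : ℝ) ^ i * 2 ^ i = 1 := by rw [← mul_pow]; norm_num
        calc A * (2 : ℝ) ^ (-B.1) = 2 ^ i * ((1 / 2) ^ i * (A * (2 : ℝ) ^ (-B.1))) := by
              rw [← mul_assoc, mul_comm (2 ^ i) ((1 / 2 : ℝ) ^ i), h5, one_mul]
          _ ≤ 2 ^ i * (5 * R k) := mul_le_mul_of_nonneg_left h4 (by positivity)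
          _ = 5 * 2 ^ i * R k := by ring
  set Q := S.sup (fun B => (j B - q).toNat) + 1 with hQ
  have hlevels : ∑ B ∈ S, A * (2 : ℝ) ^ (-B.1) ≤
      ∑ k ∈ Finset.range Q, (10 * M * 2 ^ i) * ((Z k).card * R k) := by
    rw [← Finset.sum_fiberwise_of_maps_to (s := S) (t := Finset.range Q)
      (g := fun B => (j B - q).toNat) (fun B hB =>
        Finset.mem_range.2 (Nat.lt_succ_of_le (Finset.le_sup (f := fun B => (j B - q).toNat) hB)))]
    refine Finset.sum_le_sum fun k _ => ?_
    calc ∑ B ∈ S' k, A * (2 : ℝ) ^ (-B.1)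
        ≤ ∑ y ∈ Z k, ∑ B ∈ (S' k).filter (fun B => dist (z B) y ≤ 2 * R k),
          A * (2 : ℝ) ^ (-B.1) :=
          sum_le_sum_sum_filter _ _ (fun _ => by positivity) fun B hB =>
            hZden k (z B) (Finset.mem_image_of_mem _ hB)
      _ ≤ ∑ y ∈ Z k, M * (2 * (5 * 2 ^ i * R k)) := Finset.sum_le_sum fun y _ => hcharge k y
      _ = (10 * M * 2 ^ i) * ((Z k).card * R k) := by
          rw [Finset.sum_const, nsmul_eq_mul]; ring
  have hprog := sum_range_le_of_progressions (F := fun k => ((Z k).card : ℝ) * R k)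
    (m := 7) (W := 16 * ∑ p ∈ U, ω p) (fun k => by have := hR0 k; positivity) (by omega) ?_ Q
  · refine hlevels.trans ?_
    rw [← Finset.mul_sum]
    calc 10 * M * 2 ^ i * ∑ k ∈ Finset.range Q, ((Z k).card : ℝ) * R k
        ≤ 10 * M * 2 ^ i * ((7 : ℕ) * (16 * ∑ p ∈ U, ω p)) :=
          mul_le_mul_of_nonneg_left hprog (by positivity)
      _ = 1120 * M * 2 ^ i * ∑ p ∈ U, ω p := by push_cast; ring
  intro c L
  have key := sum_isFork_le (U := U) (ω := ω) (β := β) hg hη (R := fun l => R (c + 7 * l))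
    (fun l => hR0 _) (fun l => ?_) (Z := fun l => Z (c + 7 * l)) (fun l => ?_) hω ?_
    (fun l => hZsep _) (fun l y hy => ?_) L
  · have h1 : ∑ l ∈ Finset.range L, ((Z (c + 7 * l)).card : ℝ) * R (c + 7 * l) =
        16 * ∑ l ∈ Finset.range L, ((Z (c + 7 * l)).card : ℝ) * (R (c + 7 * l) / 16) := by
      rw [Finset.mul_sum]
      exact Finset.sum_congr rfl fun l _ => by ring
    rw [h1]
    exact mul_le_mul_of_nonneg_left key (by norm_num)
  · refine le_of_eq ?_
    simp only [hR]
    ring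
  · intro y hy
    obtain ⟨B, hB, rfl⟩ := Finset.mem_image.1 (hZsub _ hy)
    obtain ⟨t, ht⟩ := hzg B (Finset.mem_filter.1 hB).1
    rw [ht]
    exact hU t
  · have h1 := hβ B₀ hB₀
    have h2 := hlow B₀ hB₀
    have h3 : (2 : ℝ) ^ q ≤ R (c + 7 * 0) :=
      le_mul_of_one_le_right (by positivity) (one_le_pow₀ (by norm_num))
    linarith
  · obtain ⟨B, hB, rfl⟩ := Finset.mem_image.1 (hZsub _ hy)
    have h1 := hfork B (Finset.mem_filter.1 hB).1
    rwa [hrad _ B hB] at h1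

end Sums

/-! ### Nets and closed walks in a connected space of finite length -/

section Length

variable {Γ : Type*} [MetricSpace Γ]

/-- In a connected space, a ball of radius `s` that does not exhaust the space has
one-dimensional Hausdorff measure at least `s`. -/
theorem ofReal_le_hausdorffMeasure_closedBall [MeasurableSpace Γ] [BorelSpace Γ]
    [ConnectedSpace Γ] {x w : Γ} {s : ℝ} (hw : s ≤ dist x w) :
    ENNReal.ofReal s ≤ μH[1] (closedBall x s) := by
  have hsub : Set.Icc 0 s ⊆ (fun v => dist x v) '' closedBall x s := by
    intro u hu
    obtain ⟨v, hv⟩ := exists_dist_eq_of_le hu.1 (hu.2.trans hw)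
    exact ⟨v, by rw [mem_closedBall, dist_comm, hv]; exact hu.2, hv⟩
  have hlip : LipschitzWith 1 fun v => dist x v := LipschitzWith.dist_right x
  have h1 := hlip.hausdorffMeasure_image_le zero_le_one (closedBall x s)
  rw [ENNReal.coe_one, ENNReal.one_rpow, one_mul, hausdorffMeasure_real] at h1
  calc ENNReal.ofReal s = volume (Set.Icc 0 s) := by rw [Real.volume_Icc, sub_zero]
    _ ≤ _ := measure_mono hsub
    _ ≤ _ := h1

theorem card_mul_le_hausdorffMeasure [MeasurableSpace Γ] [BorelSpace Γ]
    [ConnectedSpace Γ] {s : ℝ} (F : Finset Γ)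
    (hsep : ∀ x ∈ F, ∀ y ∈ F, x ≠ y → 2 * s < dist x y) (hF : ∀ x ∈ F, ∃ w, s ≤ dist x w) :
    F.card * ENNReal.ofReal s ≤ μH[1] (Set.univ : Set Γ) := by
  rw [← nsmul_eq_mul]
  calc F.card • ENNReal.ofReal s ≤ ∑ x ∈ F, μH[1] (closedBall x s) :=
        Finset.card_nsmul_le_sum _ _ _ fun x hx => by
          obtain ⟨w, hw⟩ := hF x hx
          exact ofReal_le_hausdorffMeasure_closedBall hw
    _ = μH[1] (⋃ x ∈ F, closedBall x s) := by
        refine (measure_biUnion_finset ?_ fun x _ => isClosed_closedBall.measurableSet).symm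
        intro x hx y hy hne
        refine closedBall_disjoint_closedBall ?_
        linarith [hsep x hx y hy hne]
    _ ≤ _ := measure_mono (Set.subset_univ _)

theorem exists_closed_walk_covering {V : Type*} [Fintype V] {G : SimpleGraph V}
    (hG : G.Preconnected) (v : V) :
    ∃ p : G.Walk v v, (∀ w, w ∈ p.support) ∧ p.length ≤ 2 * Fintype.card V := by
  classical
  suffices h : ∀ (k : ℕ) (p : G.Walk v v), p.length + 2 ≤ 2 * p.support.toFinset.card →
      Fintype.card V - p.support.toFinset.card = k →
      ∃ p : G.Walk v v, (∀ w, w ∈ p.support) ∧ p.length ≤ 2 * Fintype.card V from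
    h _ SimpleGraph.Walk.nil (by simp) rfl
  intro k
  induction k using Nat.strong_induction_on with
  | _ k ih =>
    intro p hp hk
    by_cases hall : ∀ w, w ∈ p.support
    · exact ⟨p, hall, by have := Finset.card_le_univ p.support.toFinset; omega⟩
    · push Not at hall
      obtain ⟨w, hw⟩ := hall
      obtain ⟨q⟩ := hG v w
      obtain ⟨d, _, hd1, hd2⟩ := q.exists_boundary_dart {u | u ∈ p.support}
        p.start_mem_support hw
      rw [Set.mem_ofPred_eq] at hd1 hd2
      set p' : G.Walk v v := (p.takeUntil d.fst hd1).append
        (SimpleGraph.Walk.cons d.adj (SimpleGraph.Walk.cons d.adj.symm (p.dropUntil d.fst hd1)))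
        with hp'
      have hlen : p'.length = p.length + 2 := by
        have h1 := congrArg SimpleGraph.Walk.length (p.take_spec hd1)
        rw [SimpleGraph.Walk.length_append] at h1
        rw [hp', SimpleGraph.Walk.length_append, SimpleGraph.Walk.length_cons,
          SimpleGraph.Walk.length_cons]
        omega
      have hsub : insert d.snd p.support.toFinset ⊆ p'.support.toFinset := by
        intro u hu
        rw [List.mem_toFinset, hp', SimpleGraph.Walk.mem_support_append_iff,
          SimpleGraph.Walk.support_cons, SimpleGraph.Walk.support_cons]
        rcases Finset.mem_insert.1 hu with rfl | hu
        · simp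
        · rw [List.mem_toFinset, ← p.take_spec hd1,
            SimpleGraph.Walk.mem_support_append_iff] at hu
          rcases hu with hu | hu
          · exact Or.inl hu
          · simp [hu]
      have hcard : p.support.toFinset.card + 1 ≤ p'.support.toFinset.card := by
        rw [← Finset.card_insert_of_notMem (show d.snd ∉ p.support.toFinset by
          rwa [List.mem_toFinset])]
        exact Finset.card_le_card hsub
      have huniv := Finset.card_le_univ p'.support.toFinset
      exact ih _ (by omega) p' (by omega) rfl

/-- A finite `ε`-dense set in a connected space is visited by a periodic walk with steps at most
`2ε`, whose period is at most twice the number of points. -/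
theorem exists_periodic_walk [ConnectedSpace Γ] {ε : ℝ} (hε : 0 ≤ ε) {V : Finset Γ}
    (hV : ∀ w, ∃ v ∈ V, dist v w ≤ ε) :
    ∃ (g : ℕ → Γ) (n : ℕ), 0 < n ∧ n ≤ 2 * V.card ∧ (∀ t, dist (g t) (g (t + 1)) ≤ 2 * ε) ∧
      (∀ t, g (t + n) = g t) ∧ (∀ t, g t ∈ V) ∧ ∀ v ∈ V, ∃ t, n ≤ t ∧ t < 2 * n ∧ v = g t := by
  classical
  let G : SimpleGraph V := SimpleGraph.fromRel fun v w => dist (v : Γ) w ≤ 2 * ε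
  have hadj : ∀ v w, G.Adj v w → dist (v : Γ) w ≤ 2 * ε := by
    intro v w h
    rcases ((SimpleGraph.fromRel_adj _ _ _).1 h).2 with h | h
    · exact h
    · rwa [dist_comm]
  have hG : G.Preconnected := by
    intro v w
    by_contra hvw
    have hclosed : ∀ P : V → Prop, IsClosed (⋃ u ∈ {u | P u}, closedBall (u : Γ) ε) := fun P =>
      (Set.toFinite {u | P u}).isClosed_biUnion fun _ _ => isClosed_closedBall
    have hpre := isPreconnected_closed_iff.1 (isPreconnected_univ (α := Γ))
      _ _ (hclosed fun u => G.Reachable v u) (hclosed fun u => ¬ G.Reachable v u) (by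
        intro x _
        obtain ⟨u, hu, hux⟩ := hV x
        rw [dist_comm] at hux
        by_cases h : G.Reachable v ⟨u, hu⟩
        · exact Or.inl (Set.mem_biUnion (x := (⟨u, hu⟩ : V)) h (mem_closedBall.2 hux))
        · exact Or.inr (Set.mem_biUnion (x := (⟨u, hu⟩ : V)) h (mem_closedBall.2 hux)))
      ⟨v, trivial, Set.mem_biUnion (x := v) (SimpleGraph.Reachable.refl v)
        (mem_closedBall_self hε)⟩
      ⟨w, trivial, Set.mem_biUnion (x := w) hvw (mem_closedBall_self hε)⟩
    obtain ⟨x, _, hx1, hx2⟩ := hpre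
    simp only [Set.mem_iUnion, Set.mem_ofPred_eq, mem_closedBall] at hx1 hx2
    obtain ⟨u, hu, hxu⟩ := hx1
    obtain ⟨u', hu', hxu'⟩ := hx2
    refine hu' (hu.trans (SimpleGraph.Adj.reachable ((SimpleGraph.fromRel_adj _ _ _).2
      ⟨fun h => hu' (h ▸ hu), Or.inl ?_⟩)))
    have := dist_triangle_left (u : Γ) u' x
    linarith
  obtain ⟨x₀⟩ := (inferInstance : Nonempty Γ)
  obtain ⟨v₀, hv₀, _⟩ := hV x₀
  obtain ⟨p, hp, hlen⟩ := exists_closed_walk_covering hG ⟨v₀, hv₀⟩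
  rw [Fintype.card_coe] at hlen
  have hVpos : 0 < V.card := Finset.card_pos.2 ⟨v₀, hv₀⟩
  rcases Nat.eq_zero_or_pos p.length with h0 | hpos
  · refine ⟨fun _ => v₀, 1, one_pos, by omega, fun t => by simpa using hε, fun _ => rfl,
      fun _ => hv₀, fun v hv => ⟨1, le_rfl, by norm_num, ?_⟩⟩
    have h1 := hp ⟨v, hv⟩
    obtain ⟨k, hk, hkl⟩ := SimpleGraph.Walk.mem_support_iff_exists_getVert.1 h1
    rw [show k = 0 by omega, SimpleGraph.Walk.getVert_zero] at hk
    exact congrArg Subtype.val hk.symm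
  · refine ⟨fun t => p.getVert (t % p.length), p.length, hpos, hlen, fun t => ?_, fun t => ?_,
      fun t => (p.getVert _).2, fun v hv => ?_⟩
    · have hlt := Nat.mod_lt t hpos
      have h1 := hadj _ _ (p.adj_getVert_succ hlt)
      beta_reduce
      rcases Nat.lt_or_ge (t % p.length + 1) p.length with h | h
      · rwa [show (t + 1) % p.length = t % p.length + 1 by
          rw [Nat.add_mod, Nat.mod_eq_of_lt (show 1 < p.length by omega), Nat.mod_eq_of_lt h]]
      · have h2 : t % p.length + 1 = p.length := by omega
        have h3 : (t + 1) % p.length = 0 := by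
          rw [← Nat.mod_add_mod, h2, Nat.mod_self]
        rw [h2, SimpleGraph.Walk.getVert_length] at h1
        rw [h3, SimpleGraph.Walk.getVert_zero]
        exact h1
    · simp
    · have h1 := hp ⟨v, hv⟩
      obtain ⟨k, hk, hkl⟩ := SimpleGraph.Walk.mem_support_iff_exists_getVert.1 h1
      refine ⟨p.length + k % p.length, by omega, by have := Nat.mod_lt k hpos; omega, ?_⟩
      beta_reduce
      rw [Nat.add_mod_left, Nat.mod_mod]
      rcases hkl.eq_or_lt with h | h
      · rw [h, Nat.mod_self, SimpleGraph.Walk.getVert_zero]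
        rw [h, SimpleGraph.Walk.getVert_length] at hk
        exact congrArg Subtype.val hk.symm
      · rw [Nat.mod_eq_of_lt h, hk]

end Length

/-! ### The bound for exponents larger than two -/

section UpperBound

variable {Γ : Type*} [MetricSpace Γ] {X : ℤ → Set Γ} {A : ℝ} {M : ℕ}

/-- The ball with center `B.1` and radius `B.2` contains a triple with defect more than `ε` times
the radius. -/
def HasDefect (ε : ℝ) (B : Γ × ℝ) : Prop :=
  ∃ y₁ y₂ y₃, dist y₁ B.1 ≤ B.2 ∧ dist y₂ B.1 ≤ B.2 ∧ dist y₃ B.1 ≤ B.2 ∧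
    ε * B.2 < defect y₁ y₂ y₃

theorem IsNestedNets.mono (hX : IsNestedNets X) : Monotone X :=
  monotone_int_of_le_succ hX.nested

/-- The balls with relative defect more than `2⁻ⁱ` satisfy a packing condition with a constant
that grows, up to a linear factor in `i`, no faster than `2ⁱ`. -/
theorem sum_radius_hasDefect_le [MeasurableSpace Γ] [BorelSpace Γ] [ConnectedSpace Γ]
    (hA : 1 < A) (hX : IsNestedNets X) (hM : FewNetPoints X A M)
    (hfin : μH[1] (Set.univ : Set Γ) ≠ ∞) (i : ℕ) (S : Finset (ℤ × Γ))
    (hSX : ∀ B ∈ S, B.2 ∈ X B.1)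
    (hbad : ∀ B ∈ S, HasDefect ((1 / 2) ^ i) (B.2, A * (2 : ℝ) ^ (-B.1))) :
    ∑ B ∈ S, A * (2 : ℝ) ^ (-B.1) ≤
      1000000 * M * ((i + 1) * 2 ^ i) * (μH[1] (Set.univ : Set Γ)).toReal := by
  classical
  set h := (μH[1] (Set.univ : Set Γ)).toReal with hh
  have hh0 : 0 ≤ h := ENNReal.toReal_nonneg
  have hA0 : 0 < A := by linarith
  rcases S.eq_empty_or_nonempty with rfl | hne
  · rw [Finset.sum_empty]; positivity
  -- a net at a scale much finer than the balls of `S`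
  obtain ⟨B₀, hB₀, hq⟩ : ∃ B₀ ∈ S, ∀ B ∈ S, B.1 ≤ B₀.1 := Finset.exists_max_image S Prod.fst hne
  set m : ℤ := B₀.1 + (i + 11 : ℕ) with hm
  set ε : ℝ := (2 : ℝ) ^ (-m) with hε
  have hε0 : 0 < ε := by positivity
  have hεS : ∀ B ∈ S, 2000 * ε ≤ (1 / 2) ^ i * (A * (2 : ℝ) ^ (-B.1)) := by
    intro B hB
    have h1 : ε = (2 : ℝ) ^ (-B₀.1) * ((1 / 2) ^ i * (1 / 2) ^ 11) := by
      rw [hε, hm, neg_add, zpow_add₀ (by norm_num), zpow_neg _ ((i + 11 : ℕ) : ℤ), zpow_natCast,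
        ← pow_add, one_div, inv_pow]
    have h2 : (2 : ℝ) ^ (-B₀.1) ≤ (2 : ℝ) ^ (-B.1) :=
      zpow_le_zpow_right₀ (by norm_num) (by linarith [hq B hB])
    have h3 : (2 : ℝ) ^ (-B.1) ≤ A * (2 : ℝ) ^ (-B.1) :=
      le_mul_of_one_le_left (by positivity) hA.le
    have h4 : (0 : ℝ) < (1 / 2) ^ i := by positivity
    have h5 : 0 < (2 : ℝ) ^ (-B₀.1) := by positivity
    calc 2000 * ε = (2000 * (1 / 2) ^ 11) * ((1 / 2) ^ i * (2 : ℝ) ^ (-B₀.1)) := by rw [h1]; ring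
      _ ≤ 1 * ((1 / 2) ^ i * (2 : ℝ) ^ (-B₀.1)) :=
        mul_le_mul_of_nonneg_right (by norm_num) (by positivity)
      _ ≤ (1 / 2) ^ i * (A * (2 : ℝ) ^ (-B.1)) := by
        rw [one_mul]
        exact mul_le_mul_of_nonneg_left (h2.trans h3) h4.le
  -- balls of radius `ε / 2` do not exhaust the space, since some triple has a large defect
  have hfar : ∀ x : Γ, ∃ w, ε / 2 ≤ dist x w := by
    intro x
    obtain ⟨y₁, y₂, y₃, _, _, _, hd⟩ := hbad B₀ hB₀
    have h1 := defect_le_dist y₁ y₂ y₃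
    have h2 := dist_triangle_left y₁ y₂ x
    have h3 := hεS B₀ hB₀
    dsimp only at hd
    by_contra hcon
    push Not at hcon
    linarith [hcon y₁, hcon y₂]
  have hcard : ∀ F : Finset Γ, (∀ x ∈ F, x ∈ X m) → F.card * ε ≤ 2 * h := by
    intro F hF
    have h1 := card_mul_le_hausdorffMeasure (s := ε / 2) F (fun x hx y hy hne => by
      have := (hX.isEpsNet m).separated x (hF x hx) y (hF y hy) hne
      linarith) fun x _ => hfar x
    have h2 := ENNReal.toReal_mono hfin h1
    rw [ENNReal.toReal_mul, ENNReal.toReal_natCast, ENNReal.toReal_ofReal (by positivity)] at h2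
    linarith
  have hXfin : (X m).Finite := by
    by_contra hinf
    obtain ⟨k, hk⟩ := exists_nat_gt (2 * h / ε)
    obtain ⟨F, hF, hFk⟩ := Set.Infinite.exists_subset_card_eq hinf k
    have h1 := hcard F fun x hx => hF hx
    rw [div_lt_iff₀ hε0, ← hFk] at hk
    linarith
  set V := hXfin.toFinset with hV
  have hVX : ∀ x, x ∈ V ↔ x ∈ X m := fun x => hXfin.mem_toFinset
  have hVcov : ∀ w, ∃ v ∈ V, dist v w ≤ ε := by
    intro w
    obtain ⟨v, hv, hvw⟩ := (hX.isEpsNet m).covers w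
    exact ⟨v, (hVX v).2 hv, hvw⟩
  have hVcard : V.card * ε ≤ 2 * h := hcard V fun x hx => (hVX x).1 hx
  obtain ⟨g, n, hn0, hn, hg, hper, hgV, hgsurj⟩ := exists_periodic_walk hε0.le hVcov
  have hlen : walkLength (3 * n) g ≤ 24 * h := by
    calc walkLength (3 * n) g ≤ ∑ t ∈ Finset.range (3 * n), 2 * ε :=
          Finset.sum_le_sum fun t _ => hg t
      _ = 6 * (n * ε) := by rw [Finset.sum_const, Finset.card_range, nsmul_eq_mul]; push_cast; ring
      _ ≤ 6 * ((2 * V.card : ℕ) * ε) := by gcongr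
      _ ≤ 24 * h := by push_cast; linarith
  have hdense : ∀ w, ∃ t, n ≤ t ∧ t < 2 * n ∧ dist w (g t) ≤ 2 * ε := by
    intro w
    obtain ⟨v, hv, hvw⟩ := hVcov w
    obtain ⟨t, h1, h2, rfl⟩ := hgsurj v hv
    exact ⟨t, h1, h2, by rw [dist_comm]; linarith⟩
  set S₁ := S.filter fun B => IsBent g (3 * n) B.2 (A * (2 : ℝ) ^ (-B.1))
    ((1 / 2) ^ i * (A * (2 : ℝ) ^ (-B.1)) / 1000) with hS₁
  set S₂ := S.filter fun B => ¬ IsBent g (3 * n) B.2 (A * (2 : ℝ) ^ (-B.1))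
    ((1 / 2) ^ i * (A * (2 : ℝ) ^ (-B.1)) / 1000) with hS₂
  have hsum₁ := sum_radius_bent_le (g := g) (T := 3 * n) hA0 hM i S₁
    (fun B hB => hSX B (Finset.mem_filter.1 hB).1) fun B hB => (Finset.mem_filter.1 hB).2
  have hω : IsCoveringWeight V (fun p => if p ∈ V then 6 * ε else 0) (2 * ε) (6 * ε) := by
    refine ⟨fun p => ?_, fun p => ?_, fun w => ?_⟩
    · split_ifs <;> positivity
    · split_ifs
      · exact le_rfl
      · positivity
    · obtain ⟨v, hv, hvw⟩ := hVcov w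
      refine ⟨v, hv, ?_⟩
      rw [if_pos hv, dist_comm]
      linarith
  have hsum₂ := sum_radius_fork_le (X := X) hA0 hM hg hgV hω i S₂
    (fun B hB => hSX B (Finset.mem_filter.1 hB).1)
    (fun B hB => by linarith [hεS B (Finset.mem_filter.1 hB).1]) (fun B hB => by
      obtain ⟨hB, hnot⟩ := Finset.mem_filter.1 hB
      have hBV : B.2 ∈ V := (hVX _).2 (hX.mono (by have := hq B hB; omega) (hSX B hB))
      obtain ⟨t, h1, h2, h3⟩ := hgsurj _ hBV
      exact (isBent_or_exists_isFork hg hper hdense ⟨t, h3, h1, h2⟩ (by positivity)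
        (by positivity) (by linarith [hεS B hB]) (hbad B hB)).resolve_left hnot)
  have hωsum : ∑ p ∈ V, (if p ∈ V then 6 * ε else 0) ≤ 12 * h := by
    rw [Finset.sum_congr rfl fun p hp => if_pos hp, Finset.sum_const, nsmul_eq_mul]
    linarith
  rw [← Finset.sum_filter_add_sum_filter_not S fun B : ℤ × Γ =>
    IsBent g (3 * n) B.2 (A * (2 : ℝ) ^ (-B.1)) ((1 / 2) ^ i * (A * (2 : ℝ) ^ (-B.1)) / 1000)]
  have h2i : (0 : ℝ) < 2 ^ i := by positivity
  have hb₁ : (i + 18) * (M * (2000 * 2 ^ i * walkLength (3 * n) g)) ≤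
      (i + 18) * (M * (2000 * 2 ^ i * (24 * h))) := by gcongr
  have hb₂ : 1120 * M * 2 ^ i * ∑ p ∈ V, (if p ∈ V then 6 * ε else 0) ≤
      1120 * M * 2 ^ i * (12 * h) := by gcongr
  have hfinal : (0 : ℝ) ≤ M * 2 ^ i * h := by positivity
  have hi : (0 : ℝ) ≤ i := Nat.cast_nonneg i
  nlinarith [mul_nonneg hi hfinal]

/-- A single term of the sum is dominated by the level `i` with `2⁻ⁱ < β² ≤ 2 · 2⁻ⁱ`; such a level
`i ≥ 0` exists because `β² ≤ 2`. -/
theorem betaInf_rpow_mul_ediam_le {p : ℝ} (hp : 0 < p) {B : Γ × ℝ} (hB : 0 < B.2) :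
    betaInf B ^ p * ediam (ballSet B) ≤
      ∑' i : ℕ, ENNReal.ofReal ((2 * (1 / 2) ^ i) ^ (p / 2)) *
        (Set.indicator {B | HasDefect ((1 / 2) ^ i) B} (fun B => ENNReal.ofReal (2 * B.2)) B) := by
  classical
  set s := ⨆ x ∈ ballSet B, ⨆ y ∈ ballSet B, ⨆ z ∈ ballSet B, ENNReal.ofReal (defect x y z) with hs
  have hs2 : s ≤ ENNReal.ofReal (2 * B.2) := by
    refine iSup₂_le fun x hx => iSup₂_le fun y hy => iSup₂_le fun z hz => ?_
    refine ENNReal.ofReal_le_ofReal ((defect_le_dist x y z).trans ?_)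
    have := dist_triangle_right x y B.1
    linarith [mem_closedBall.1 hx, mem_closedBall.1 hy]
  have hs_ne_top : s ≠ ∞ := ne_top_of_le_ne_top ENNReal.ofReal_ne_top hs2
  have hdiam : ediam (ballSet B) ≤ ENNReal.ofReal (2 * B.2) := by
    refine ediam_le fun x hx y hy => ?_
    rw [edist_dist]
    refine ENNReal.ofReal_le_ofReal ?_
    have := dist_triangle_right x y B.1
    linarith [mem_closedBall.1 hx, mem_closedBall.1 hy]
  have hbeta : betaInf B ^ p = ENNReal.ofReal ((s.toReal / B.2) ^ (p / 2)) := by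
    have h1 : (ENNReal.ofReal B.2)⁻¹ * s = ENNReal.ofReal (s.toReal / B.2) := by
      rw [div_eq_inv_mul, ENNReal.ofReal_mul (by positivity), ENNReal.ofReal_inv_of_pos hB,
        ENNReal.ofReal_toReal hs_ne_top]
    rw [betaInf, ← hs, h1, ← ENNReal.rpow_mul, ENNReal.ofReal_rpow_of_nonneg
      (by positivity) (by positivity)]
    congr 2
    ring
  set a := s.toReal / B.2 with ha
  have ha2 : a ≤ 2 := by
    rw [ha, div_le_iff₀ hB]
    exact ENNReal.toReal_le_of_le_ofReal (by positivity) hs2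
  have ha0 : 0 ≤ a := by positivity
  rw [hbeta]
  rcases ha0.eq_or_lt with h0 | hpos
  · rw [← h0, Real.zero_rpow (by positivity), ENNReal.ofReal_zero, zero_mul]
    exact zero_le
  obtain ⟨i, hi1, hi2⟩ := exists_nat_pow_near_of_lt_one (x := a / 2) (y := (1 / 2 : ℝ))
    (by positivity) (by linarith) (by norm_num) (by norm_num)
  have hmem : HasDefect ((1 / 2) ^ i) B := by
    have h1 : ENNReal.ofReal ((1 / 2) ^ i * B.2) < s := by
      rw [ENNReal.ofReal_lt_iff_lt_toReal (by positivity) hs_ne_top, ← lt_div_iff₀ hB]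
      rw [pow_succ] at hi1
      linarith
    rw [hs] at h1
    simp only [lt_iSup_iff] at h1
    obtain ⟨x, hx, y, hy, z, hz, h1⟩ := h1
    exact ⟨x, y, z, mem_closedBall.1 hx, mem_closedBall.1 hy, mem_closedBall.1 hz,
      (ENNReal.ofReal_lt_ofReal_iff_of_nonneg (by positivity)).1 h1⟩
  refine le_trans ?_ (ENNReal.le_tsum i)
  rw [Set.indicator_of_mem (by exact hmem)]
  refine mul_le_mul' (ENNReal.ofReal_le_ofReal ?_) hdiam
  exact Real.rpow_le_rpow ha0 (by linarith) (by positivity)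

theorem tsum_hasDefect_le [MeasurableSpace Γ] [BorelSpace Γ] [ConnectedSpace Γ]
    (hA : 1 < A) (hX : IsNestedNets X) (hM : FewNetPoints X A M)
    (hfin : μH[1] (Set.univ : Set Γ) ≠ ∞) (i : ℕ) :
    ∑' B : multiresolutionFamily A X,
      Set.indicator {B | HasDefect ((1 / 2) ^ i) B} (fun B => ENNReal.ofReal (2 * B.2)) B.1 ≤
      ENNReal.ofReal (2000000 * M * ((i + 1) * 2 ^ i)) * μH[1] (Set.univ : Set Γ) := by
  classical
  rw [ENNReal.tsum_eq_iSup_sum]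
  refine iSup_le fun F => ?_
  choose n hn using fun B : multiresolutionFamily A X => B.2
  have hA0 : 0 < A := by linarith
  set F' := F.filter fun B => HasDefect ((1 / 2) ^ i) B.1 with hF'
  set S : Finset (ℤ × Γ) := F'.image fun B => (n B, B.1.1) with hS
  have hinj : Set.InjOn (fun B : multiresolutionFamily A X => (n B, B.1.1)) F' := by
    intro B _ B' _ hBB'
    obtain ⟨h1, h2⟩ := Prod.ext_iff.1 hBB'
    simp only at h1 h2
    exact Subtype.ext (Prod.ext h2 (by rw [(hn B).2, (hn B').2, h1]))
  have hsum := sum_radius_hasDefect_le hA hX hM hfin i S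
    (fun B hB => by
      obtain ⟨B', hB', rfl⟩ := Finset.mem_image.1 hB
      exact (hn B').1)
    (fun B hB => by
      obtain ⟨B', hB', rfl⟩ := Finset.mem_image.1 hB
      have h1 := (Finset.mem_filter.1 hB').2
      rwa [show B'.1 = (B'.1.1, A * (2 : ℝ) ^ (-n B')) from Prod.ext rfl (hn B').2] at h1)
  rw [hS, Finset.sum_image hinj] at hsum
  have h1 : ∑ B ∈ F, Set.indicator {B | HasDefect ((1 / 2) ^ i) B}
      (fun B : Γ × ℝ => ENNReal.ofReal (2 * B.2)) B.1 =
      ENNReal.ofReal (2 * ∑ B ∈ F', A * (2 : ℝ) ^ (-n B)) := by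
    rw [Finset.mul_sum, ENNReal.ofReal_sum_of_nonneg fun _ _ => by positivity, hF',
      Finset.sum_filter]
    refine Finset.sum_congr rfl fun B _ => ?_
    rw [Set.indicator_apply, ← (hn B).2]
    rfl
  rw [h1, ← ENNReal.ofReal_toReal hfin, ← ENNReal.ofReal_mul (by positivity)]
  refine ENNReal.ofReal_le_ofReal ?_
  linarith

theorem exists_betaSum_le {p : ℝ} (hp : 2 < p) (N : ℕ) {A : ℝ} (hA : 1 < A) :
    ∃ C : ℝ≥0, ∀ (Γ : Type*) [MetricSpace Γ] [MeasurableSpace Γ] [BorelSpace Γ]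
      [ConnectedSpace Γ] (X : ℤ → Set Γ), IsDoublingWith Γ N → IsNestedNets X →
        betaSum p A X ≤ (C : ℝ≥0∞) * μH[1] (Set.univ : Set Γ) := by
  obtain ⟨k, hk⟩ := pow_unbounded_of_one_lt (28 * A) (one_lt_two (α := ℝ))
  set c : ℕ → ℝ := fun i =>
    (2 * (1 / 2) ^ i) ^ (p / 2) * (2000000 * (N ^ k : ℕ) * ((i + 1) * 2 ^ i)) with hc
  have hc0 : ∀ i, 0 ≤ c i := fun i => by positivity
  have hsum : Summable c := by
    set x : ℝ := (1 / 2) ^ (p / 2) * 2 with hx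
    have hx0 : 0 ≤ x := by positivity
    have hx1 : x < 1 := by
      have : (1 / 2 : ℝ) ^ (p / 2) < (1 / 2) ^ (1 : ℝ) :=
        Real.rpow_lt_rpow_of_exponent_gt (by norm_num) (by norm_num) (by linarith)
      rw [Real.rpow_one] at this
      linarith
    have h1 := summable_pow_mul_geometric_of_norm_lt_one (R := ℝ) 1
      (show ‖x‖ < 1 by rwa [Real.norm_of_nonneg hx0])
    have h2 := summable_geometric_of_lt_one hx0 hx1
    refine ((h1.add h2).mul_left ((2 : ℝ) ^ (p / 2) * (2000000 * (N ^ k : ℕ)))).congr fun i => ?_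
    have h3 : ((1 / 2 : ℝ) ^ i) ^ (p / 2) = ((1 / 2) ^ (p / 2)) ^ i := by
      rw [← Real.rpow_natCast, ← Real.rpow_natCast, ← Real.rpow_mul (by norm_num),
        ← Real.rpow_mul (by norm_num), mul_comm]
    rw [hc]
    dsimp only
    rw [Real.mul_rpow (by norm_num) (by positivity), h3, hx, mul_pow]
    ring
  -- adding `1` makes the constant nonzero, so that a space of infinite length is no exception
  refine ⟨(∑' i, c i).toNNReal + 1, fun Γ _ _ _ _ X hΓ hX => ?_⟩
  by_cases hfin : μH[1] (Set.univ : Set Γ) = ∞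
  · rw [hfin, ENNReal.mul_top (by simp)]
    exact le_top
  have hA0 : 0 < A := by linarith
  have hM := hX.fewNetPoints hΓ hk.le
  calc betaSum p A X
      ≤ ∑' B : multiresolutionFamily A X, ∑' i : ℕ,
          ENNReal.ofReal ((2 * (1 / 2) ^ i) ^ (p / 2)) *
          (Set.indicator {B | HasDefect ((1 / 2) ^ i) B}
            (fun B => ENNReal.ofReal (2 * B.2)) B.1) := by
        refine ENNReal.tsum_le_tsum fun B => betaInf_rpow_mul_ediam_le (by linarith) ?_
        obtain ⟨n, _, hn⟩ := B.2
        rw [hn]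
        positivity
    _ = ∑' i : ℕ, ENNReal.ofReal ((2 * (1 / 2) ^ i) ^ (p / 2)) *
          ∑' B : multiresolutionFamily A X, (Set.indicator {B | HasDefect ((1 / 2) ^ i) B}
            (fun B => ENNReal.ofReal (2 * B.2)) B.1) := by
        rw [ENNReal.tsum_comm]
        exact tsum_congr fun i => ENNReal.tsum_mul_left
    _ ≤ ∑' i : ℕ, ENNReal.ofReal (c i) * μH[1] (Set.univ : Set Γ) := by
        refine ENNReal.tsum_le_tsum fun i => ?_
        rw [hc, ENNReal.ofReal_mul (by positivity), mul_assoc]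
        exact mul_le_mul_right (tsum_hasDefect_le hA hX hM hfin i) _
    _ = ENNReal.ofReal (∑' i, c i) * μH[1] (Set.univ : Set Γ) := by
        rw [ENNReal.tsum_mul_right, ENNReal.ofReal_tsum_of_nonneg hc0 hsum]
    _ ≤ _ := by
        refine mul_le_mul_left ?_ _
        rw [ENNReal.coe_add]
        exact le_self_add

end UpperBound

/-! ### Existence of nested nets -/

section Nets

variable {Γ : Type*} [MetricSpace Γ]

theorem exists_isEpsNet_superset {ε : ℝ} {Y : Set Γ}
    (hY : ∀ x ∈ Y, ∀ y ∈ Y, x ≠ y → ε < dist x y) (hε : 0 ≤ ε) :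
    ∃ Z, Y ⊆ Z ∧ IsEpsNet ε Z := by
  obtain ⟨Z, hYZ, hZ⟩ := zorn_subset_nonempty
    {S : Set Γ | ∀ x ∈ S, ∀ y ∈ S, x ≠ y → ε < dist x y} (by
      intro c hc hchain _
      refine ⟨⋃₀ c, ?_, fun s hs => Set.subset_sUnion_of_mem hs⟩
      rintro x ⟨s, hs, hx⟩ y ⟨t, ht, hy⟩ hne
      rcases hchain.total hs ht with h | h
      · exact hc ht x (h hx) y hy hne
      · exact hc hs x hx y (h hy) hne) Y hY
  refine ⟨Z, hYZ, hZ.prop, fun y => ?_⟩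
  by_contra hcon
  push Not at hcon
  have hins : insert y Z ⊆ Z := hZ.le_of_ge (y := insert y Z) (by
    intro u hu v hv hne
    rcases hu with hu | hu <;> rcases hv with hv | hv
    · exact absurd (hu.trans hv.symm) hne
    · rw [hu, dist_comm]; exact hcon v hv
    · rw [hv]; exact hcon u hu
    · exact hZ.prop u hu v hv hne) (Set.subset_insert y Z)
  have := hcon y (hins (Set.mem_insert y Z))
  rw [dist_self] at this
  linarith

/-- A bounded space has nested nets: a single point at the scales above the diameter, and
successive maximal separated extensions below. -/
theorem exists_isNestedNets [Nonempty Γ] {D : ℝ} (hD : ∀ x y : Γ, dist x y ≤ D) :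
    ∃ X : ℤ → Set Γ, IsNestedNets X := by
  obtain ⟨x₀⟩ := (inferInstance : Nonempty Γ)
  obtain ⟨m, hm⟩ := pow_unbounded_of_one_lt D (one_lt_two (α := ℝ))
  have hext : ∀ n : ℤ, ∀ Y : Set Γ, IsEpsNet ((2 : ℝ) ^ (-n)) Y →
      ∃ Z, Y ⊆ Z ∧ IsEpsNet ((2 : ℝ) ^ (-(n + 1))) Z := by
    intro n Y hY
    refine exists_isEpsNet_superset (fun x hx y hy hne => ?_) (by positivity)
    exact (zpow_le_zpow_right₀ (by norm_num) (by omega)).trans_lt (hY.separated x hx y hy hne)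
  choose! next hsub hnet using hext
  have hsingle : ∀ n : ℤ, n ≤ -m → IsEpsNet ((2 : ℝ) ^ (-n)) {x₀} := by
    intro n hn
    refine ⟨fun x hx y hy hne => absurd (hx.trans hy.symm) hne, fun y => ⟨x₀, rfl, ?_⟩⟩
    calc dist x₀ y ≤ 2 ^ m := (hD x₀ y).trans hm.le
      _ = (2 : ℝ) ^ (m : ℤ) := (zpow_natCast _ _).symm
      _ ≤ _ := zpow_le_zpow_right₀ (by norm_num) (by omega)
  let F : ℕ → Set Γ := Nat.rec {x₀} fun k Y => next (-m + k) Y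
  have hFsucc : ∀ k, F (k + 1) = next (-m + k) (F k) := fun _ => rfl
  have hF : ∀ k : ℕ, IsEpsNet ((2 : ℝ) ^ (-(-m + k : ℤ))) (F k) := by
    intro k
    induction k with
    | zero => exact hsingle _ (by simp)
    | succ k ih =>
      rw [hFsucc, Nat.cast_succ, ← add_assoc]
      exact hnet _ _ ih
  refine ⟨fun n => F (n + m).toNat, fun n => ?_, fun n => ?_⟩
  · rcases le_total n (-m) with h | h
    · rw [show (n + m).toNat = 0 by omega]
      exact hsingle n h
    · have h1 := hF (n + m).toNat
      rwa [show (-m + ((n + m).toNat : ℤ)) = n by omega] at h1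
  · rcases lt_or_ge n (-m) with h | h
    · rw [show (n + m).toNat = 0 by omega, show (n + 1 + m).toNat = 0 by omega]
    · rw [show (n + 1 + m).toNat = (n + m).toNat + 1 by omega, hFsucc]
      exact hsub _ _ (hF _)

end Nets

/-! ### A comb with spikes of many sizes -/

section Comb

/-- The point with coordinates `(x, y)` in the plane with the `ℓ¹` metric, realized as the
plane with the supremum metric by a rotation. -/
def planePoint (x y : ℝ) : ℝ × ℝ := (x + y, x - y)

theorem dist_planePoint (x y x' y' : ℝ) :
    dist (planePoint x y) (planePoint x' y') = |x - x'| + |y - y'| := by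
  rw [Prod.dist_eq, Real.dist_eq, Real.dist_eq]
  simp only [planePoint]
  rcases abs_cases (x - x') with h | h <;> rcases abs_cases (y - y') with h' | h' <;>
    rcases abs_cases (x + y - (x' + y')) with h'' | h'' <;>
    rcases abs_cases (x - y - (x' - y')) with h''' | h''' <;>
    rcases max_cases |x + y - (x' + y')| |x - y - (x' - y')| with h4 | h4 <;> linarith

/-- The horizontal base of the comb. -/
def combBase : Set (ℝ × ℝ) := (fun x => planePoint x 0) '' Set.Icc (-1) 2

/-- The vertical spike of height `h` at position `z`. -/
def combSpike (z h : ℝ) : Set (ℝ × ℝ) := (fun y => planePoint z y) '' Set.Icc 0 h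

/-- The height of the spikes of generation `k`. -/
noncomputable def spikeHeight (a k : ℕ) : ℝ := (1 / 2) ^ (a * (k + 1))

/-- The position of the `j`-th spike of generation `k`. -/
noncomputable def spikePos (a k j : ℕ) : ℝ := j * (1 / 2) ^ (a * k)

/-- The comb with `2ᵃ` generations of spikes: those of generation `k` have spacing `2⁻ᵃᵏ` and
height `2⁻ᵃ⁽ᵏ⁺¹⁾`, so that the spikes of one generation have total length `2⁻ᵃ`. -/
def comb (a : ℕ) : Set (ℝ × ℝ) :=
  combBase ∪ ⋃ k ∈ Finset.range (2 ^ a), ⋃ j ∈ Finset.range (2 ^ (a * k)),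
    combSpike (spikePos a k j) (spikeHeight a k)

theorem spikeHeight_pos (a k : ℕ) : 0 < spikeHeight a k := by
  unfold spikeHeight; positivity

theorem spikePos_mem_Ico {a k j : ℕ} (hj : j < 2 ^ (a * k)) :
    0 ≤ spikePos a k j ∧ spikePos a k j < 1 := by
  unfold spikePos
  refine ⟨by positivity, ?_⟩
  rw [one_div, inv_pow, ← div_eq_mul_inv, div_lt_one (by positivity)]
  exact_mod_cast hj

theorem sum_spikeHeight (a : ℕ) (c : ℝ) :
    ∑ k ∈ Finset.range (2 ^ a), ∑ _j ∈ Finset.range (2 ^ (a * k)), c * spikeHeight a k = c := by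
  have h1 : ∀ k, ∑ _j ∈ Finset.range (2 ^ (a * k)), c * spikeHeight a k = c * (1 / 2) ^ a := by
    intro k
    rw [Finset.sum_const, Finset.card_range, nsmul_eq_mul, spikeHeight, mul_add, pow_add]
    have h2 : (2 : ℝ) ^ (a * k) * (1 / 2) ^ (a * k) = 1 := by rw [← mul_pow]; norm_num
    push_cast
    rw [mul_one]
    linear_combination c * (1 / 2) ^ a * h2
  have h3 : (2 : ℝ) ^ a * (1 / 2) ^ a = 1 := by rw [← mul_pow]; norm_num
  rw [Finset.sum_congr rfl fun k _ => h1 k, Finset.sum_const, Finset.card_range, nsmul_eq_mul]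
  push_cast
  linear_combination c * h3

theorem planePoint_base_mem_comb (a : ℕ) {x : ℝ} (h1 : -1 ≤ x) (h2 : x ≤ 2) :
    planePoint x 0 ∈ comb a := Or.inl ⟨x, ⟨h1, h2⟩, rfl⟩

theorem planePoint_spike_mem_comb {a k j : ℕ} (hk : k < 2 ^ a) (hj : j < 2 ^ (a * k)) {y : ℝ}
    (h1 : 0 ≤ y) (h2 : y ≤ spikeHeight a k) : planePoint (spikePos a k j) y ∈ comb a := by
  refine Or.inr ?_
  simp only [Set.mem_iUnion, Finset.mem_range]
  exact ⟨k, hk, j, hj, y, ⟨h1, h2⟩, rfl⟩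

theorem isometry_planePoint_left (y : ℝ) : Isometry fun x => planePoint x y :=
  Isometry.of_dist_eq fun x x' => by simp [dist_planePoint, Real.dist_eq]

theorem isometry_planePoint_right (x : ℝ) : Isometry fun y => planePoint x y :=
  Isometry.of_dist_eq fun y y' => by simp [dist_planePoint, Real.dist_eq]

theorem hausdorffMeasure_comb_le (a : ℕ) : μH[1] (comb a) ≤ 4 := by
  have hbase : μH[1] combBase = ENNReal.ofReal 3 := by
    rw [combBase, (isometry_planePoint_left 0).hausdorffMeasure_image (Or.inl zero_le_one),
      hausdorffMeasure_real, Real.volume_Icc]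
    norm_num
  have hspike : ∀ z h, μH[1] (combSpike z h) = ENNReal.ofReal h := by
    intro z h
    rw [combSpike, (isometry_planePoint_right z).hausdorffMeasure_image (Or.inl zero_le_one),
      hausdorffMeasure_real, Real.volume_Icc, sub_zero]
  have hsum := sum_spikeHeight a 1
  simp only [one_mul] at hsum
  have hspikes : ∑ k ∈ Finset.range (2 ^ a), ∑ j ∈ Finset.range (2 ^ (a * k)),
      μH[1] (combSpike (spikePos a k j) (spikeHeight a k)) = ENNReal.ofReal 1 := by
    simp only [hspike]
    rw [← congrArg ENNReal.ofReal hsum, ENNReal.ofReal_sum_of_nonneg fun k _ =>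
      Finset.sum_nonneg fun _ _ => (spikeHeight_pos a k).le]
    refine Finset.sum_congr rfl fun k _ => ?_
    rw [ENNReal.ofReal_sum_of_nonneg fun _ _ => (spikeHeight_pos a k).le]
  calc μH[1] (comb a) ≤ μH[1] combBase + ∑ k ∈ Finset.range (2 ^ a),
        ∑ j ∈ Finset.range (2 ^ (a * k)), μH[1] (combSpike (spikePos a k j) (spikeHeight a k)) :=
        (measure_union_le _ _).trans (by
          gcongr
          refine (measure_biUnion_finset_le _ _).trans ?_
          exact Finset.sum_le_sum fun k _ => measure_biUnion_finset_le _ _)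
    _ = ENNReal.ofReal 3 + ENNReal.ofReal 1 := by
        rw [hbase, hspikes]
    _ = 4 := by
        rw [← ENNReal.ofReal_add (by norm_num) (by norm_num), show (3 : ℝ) + 1 = (4 : ℕ) by norm_num,
          ENNReal.ofReal_natCast]
        rfl

theorem isConnected_comb (a : ℕ) : IsConnected (comb a) := by
  have hbase : IsPreconnected combBase :=
    isPreconnected_Icc.image _ (isometry_planePoint_left 0).continuous.continuousOn
  have h0 : planePoint 0 0 ∈ combBase := ⟨0, ⟨by norm_num, by norm_num⟩, rfl⟩
  refine ⟨⟨_, Or.inl h0⟩, isPreconnected_of_forall (planePoint 0 0) ?_⟩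
  rintro y (hy | hy)
  · exact ⟨combBase, Set.subset_union_left, h0, hy, hbase⟩
  · simp only [Set.mem_iUnion, Finset.mem_range] at hy
    obtain ⟨k, hk, j, hj, hy⟩ := hy
    have hpos := spikePos_mem_Ico hj
    refine ⟨combBase ∪ combSpike (spikePos a k j) (spikeHeight a k), ?_, Or.inl h0, Or.inr hy, ?_⟩
    · refine Set.union_subset Set.subset_union_left ?_
      rintro _ ⟨u, hu, rfl⟩
      exact planePoint_spike_mem_comb hk hj hu.1 hu.2
    · refine IsPreconnected.union (planePoint (spikePos a k j) 0)
        ⟨_, ⟨by linarith, by linarith⟩, rfl⟩ ⟨0, ⟨le_rfl, (spikeHeight_pos a k).le⟩, rfl⟩ hbase ?_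
      exact isPreconnected_Icc.image _ (isometry_planePoint_right _).continuous.continuousOn

theorem dist_le_of_mem_comb {a : ℕ} {p q : ℝ × ℝ} (hp : p ∈ comb a) (hq : q ∈ comb a) :
    dist p q ≤ 8 := by
  have key : ∀ p ∈ comb a, dist p (planePoint 0 0) ≤ 4 := by
    rintro p (⟨x, hx, rfl⟩ | hp)
    · beta_reduce
      rw [dist_planePoint, sub_zero, sub_zero, abs_zero, add_zero, abs_le]
      constructor <;> linarith [hx.1, hx.2]
    · simp only [Set.mem_iUnion, Finset.mem_range] at hp
      obtain ⟨k, hk, j, hj, y, hy, rfl⟩ := hp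
      have hpos := spikePos_mem_Ico hj
      have hh : spikeHeight a k ≤ 1 := pow_le_one₀ (by norm_num) (by norm_num)
      beta_reduce
      rw [dist_planePoint, sub_zero, sub_zero, abs_of_nonneg hpos.1, abs_of_nonneg hy.1]
      linarith [hy.2]
  linarith [dist_triangle_right p q (planePoint 0 0), key p hp, key q hq]

/-- Subsets of the plane are doubling with a common constant: a square of side `2r` consists of
`25` cells of side `r / 2` of a grid. -/
theorem isDoublingWith_subset_plane (Γ : Set (ℝ × ℝ)) : IsDoublingWith Γ 25 := by
  classical
  intro x r hr
  let cell : Γ → ℤ × ℤ := fun p =>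
    (⌊(p.1.1 - x.1.1) / (r / 2)⌋, ⌊(p.1.2 - x.1.2) / (r / 2)⌋)
  let pick : ℤ × ℤ → Γ := fun c => if h : ∃ p, cell p = c then h.choose else x
  have hpick : ∀ p, cell (pick (cell p)) = cell p := by
    intro p
    have h : ∃ q, cell q = cell p := ⟨p, rfl⟩
    simp only [pick, dif_pos h]
    exact h.choose_spec
  have hfloor : ∀ u : ℝ, |u| ≤ r → ⌊u / (r / 2)⌋ ∈ Finset.Icc (-2 : ℤ) 2 := by
    intro u hu
    rw [abs_le] at hu
    rw [Finset.mem_Icc, Int.le_floor]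
    refine ⟨?_, Int.lt_add_one_iff.1 (Int.floor_lt.2 ?_)⟩
    · rw [le_div_iff₀ (by positivity)]
      push_cast
      linarith
    · rw [div_lt_iff₀ (by positivity)]
      push_cast
      linarith
  have hclose : ∀ u v w : ℝ, ⌊(u - w) / (r / 2)⌋ = ⌊(v - w) / (r / 2)⌋ → |u - v| ≤ r / 2 := by
    intro u v w h
    have h1 := Int.abs_sub_lt_one_of_floor_eq_floor h
    rw [← sub_div, sub_sub_sub_cancel_right, abs_div, abs_of_pos (by positivity : 0 < r / 2),
      div_lt_one (by positivity)] at h1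
    exact h1.le
  refine ⟨(Finset.Icc (-2 : ℤ) 2 ×ˢ Finset.Icc (-2 : ℤ) 2).image pick,
    Finset.card_image_le.trans (by decide), fun p hp => ?_⟩
  have hp' : dist p.1 x.1 ≤ r := mem_closedBall.1 hp
  rw [Prod.dist_eq, max_le_iff, Real.dist_eq, Real.dist_eq] at hp'
  simp only [Set.mem_iUnion]
  refine ⟨pick (cell p), Finset.mem_image_of_mem _
    (Finset.mem_product.2 ⟨hfloor _ hp'.1, hfloor _ hp'.2⟩), ?_⟩
  have h := Prod.ext_iff.1 (hpick p)
  rw [mem_closedBall, Subtype.dist_eq, Prod.dist_eq, max_le_iff, Real.dist_eq, Real.dist_eq]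
  exact ⟨hclose _ _ _ h.1.symm, hclose _ _ _ h.2.symm⟩

/-- A ball centered near a spike and larger than it sees the tip of the spike and two points of
the base on both sides; their defect is twice the height. -/
theorem le_betaInf_rpow_mul_ediam_comb {a k j : ℕ} (hk : k < 2 ^ a) (hj : j < 2 ^ (a * k))
    {A ρ : ℝ} (hA : 1 < A) (hρ : 0 < ρ) (hρ1 : A * ρ ≤ 1)
    (hh : spikeHeight a k ≤ (A - 1) * ρ) {x : comb a}
    (hx : dist x.1 (planePoint (spikePos a k j) 0) ≤ ρ) :
    ENNReal.ofReal (4 * (A - 1) / A * spikeHeight a k) ≤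
      betaInf (x, A * ρ) ^ (2 : ℝ) * ediam (ballSet (x, A * ρ)) := by
  set z := spikePos a k j with hz
  set h := spikeHeight a k with hhdef
  set s := (A - 1) * ρ with hs
  have hh0 : 0 < h := spikeHeight_pos a k
  have hpos := spikePos_mem_Ico hj
  have hs1 : s ≤ 1 := by
    have : s = A * ρ - ρ := by rw [hs]; ring
    linarith
  have hAρ : ρ + s = A * ρ := by rw [hs]; ring
  let P : comb a := ⟨planePoint (z - s) 0, planePoint_base_mem_comb a (by linarith) (by linarith)⟩
  let Q : comb a := ⟨planePoint (z + s) 0, planePoint_base_mem_comb a (by linarith) (by linarith)⟩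
  let T : comb a := ⟨planePoint z h, planePoint_spike_mem_comb hk hj hh0.le le_rfl⟩
  have hs0 : 0 < s := by linarith
  have hmem : ∀ y : comb a, dist y.1 (planePoint z 0) ≤ s → y ∈ ballSet (x, A * ρ) := by
    intro y hy
    have h1 := dist_triangle_right y.1 x.1 (planePoint z 0)
    rw [ballSet, mem_closedBall, Subtype.dist_eq]
    linarith
  have hP : P ∈ ballSet (x, A * ρ) := hmem P (by
    simp [P, dist_planePoint, abs_of_pos hs0])
  have hQ : Q ∈ ballSet (x, A * ρ) := hmem Q (by
    simp [Q, dist_planePoint, abs_of_pos hs0])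
  have hT : T ∈ ballSet (x, A * ρ) := hmem T (by
    simpa [T, dist_planePoint, abs_of_pos hh0] using hh)
  have dPQ : dist P Q = 2 * s := by
    rw [Subtype.dist_eq, dist_planePoint, show z - s - (z + s) = -(2 * s) by ring, abs_neg,
      abs_of_pos (by positivity), sub_zero, abs_zero, add_zero]
  have dPT : dist P T = s + h := by
    rw [Subtype.dist_eq, dist_planePoint, show z - s - z = -s by ring, zero_sub, abs_neg, abs_neg,
      abs_of_pos hs0, abs_of_pos hh0]
  have dTQ : dist T Q = s + h := by
    rw [Subtype.dist_eq, dist_planePoint, show z - (z + s) = -s by ring, sub_zero, abs_neg,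
      abs_of_pos hs0, abs_of_pos hh0]
  have hdef : 2 * h ≤ defect P T Q := by
    refine le_defect ?_ ?_ ?_
    · unfold orderedDefect; linarith
    · unfold orderedDefect; rw [dist_comm T P]; linarith
    · unfold orderedDefect; rw [dist_comm Q T]; linarith
  have hr : 0 < A * ρ := by positivity
  have hbeta : ENNReal.ofReal (2 * h / (A * ρ)) ≤ betaInf (x, A * ρ) ^ (2 : ℝ) := by
    rw [betaInf, ← ENNReal.rpow_mul, one_div, inv_mul_cancel₀ (by norm_num), ENNReal.rpow_one,
      div_eq_inv_mul, ENNReal.ofReal_mul (by positivity), ENNReal.ofReal_inv_of_pos hr]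
    refine mul_le_mul_right ?_ _
    exact (ENNReal.ofReal_le_ofReal hdef).trans (le_iSup₂_of_le P hP
      (le_iSup₂_of_le T hT (le_iSup₂_of_le Q hQ le_rfl)))
  have hdiam : ENNReal.ofReal (2 * s) ≤ ediam (ballSet (x, A * ρ)) := by
    rw [← dPQ, ← edist_dist]
    exact edist_le_ediam_of_mem hP hQ
  refine le_trans (le_of_eq ?_) (mul_le_mul' hbeta hdiam)
  rw [← ENNReal.ofReal_mul (by positivity)]
  congr 1
  rw [hs]
  field_simp
  ring

/-- Each spike is seen by one ball at each of `L` scales, where `L` is about `a`; the spikes of all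
generations have total length one. -/
theorem le_betaSum_comb {A : ℝ} (hA : 1 < A) {c L a : ℕ} (hc : A ≤ 2 ^ c)
    (hc' : 1 ≤ (A - 1) * 2 ^ c) (ha : a = 2 * c + 2 + L) {X : ℤ → Set (comb a)}
    (hX : IsNestedNets X) : ENNReal.ofReal (4 * (A - 1) / A * L) ≤ betaSum 2 A X := by
  classical
  let ι := Σ k : Fin (2 ^ a), Fin (2 ^ (a * (k : ℕ))) × Fin L
  let scale : ι → ℕ := fun i => a * (i.1 : ℕ) + (c + 2 + i.2.2)
  let foot : ι → comb a := fun i => ⟨planePoint (spikePos a i.1 i.2.1) 0, by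
    have := spikePos_mem_Ico i.2.1.2
    exact planePoint_base_mem_comb a (by linarith) (by linarith)⟩
  choose x hx hxd using fun i : ι => (hX.isEpsNet (scale i)).covers (foot i)
  have hzpow : ∀ n : ℕ, (2 : ℝ) ^ (-(n : ℤ)) = (1 / 2) ^ n := by
    intro n
    rw [zpow_neg, zpow_natCast, one_div, inv_pow]
  let ball : ι → multiresolutionFamily A X := fun i =>
    ⟨(x i, A * (2 : ℝ) ^ (-(scale i : ℤ))), scale i, hx i, rfl⟩
  have hinj : Function.Injective ball := by
    rintro ⟨k, j, l⟩ ⟨k', j', l'⟩ h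
    have h1 : x ⟨k, j, l⟩ = x ⟨k', j', l'⟩ := congrArg (fun B => B.1.1) h
    have h2 : A * (2 : ℝ) ^ (-(scale ⟨k, j, l⟩ : ℤ)) = A * (2 : ℝ) ^ (-(scale ⟨k', j', l'⟩ : ℤ)) :=
      congrArg (fun B => B.1.2) h
    have h3 : scale ⟨k, j, l⟩ = scale ⟨k', j', l'⟩ := by
      have := zpow_right_injective₀ (by norm_num) (by norm_num)
        (mul_left_cancel₀ (by linarith : A ≠ 0) h2)
      omega
    have hl : c + 2 + (l : ℕ) < a := by have := l.2; omega
    have hl' : c + 2 + (l' : ℕ) < a := by have := l'.2; omega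
    have h4 : (l : ℕ) = l' := by
      have := congrArg (· % a) h3
      simp only [scale, Nat.mul_add_mod, Nat.mod_eq_of_lt hl, Nat.mod_eq_of_lt hl'] at this
      omega
    have h5 : (k : ℕ) = k' := by
      have : a * (k : ℕ) = a * k' := by
        simp only [scale] at h3
        omega
      exact Nat.eq_of_mul_eq_mul_left (by omega) this
    obtain rfl := Fin.ext h5
    obtain rfl := Fin.ext h4
    -- at the scales used for generation `k`, distinct spikes have distinct net points
    have h6 : j = j' := by
      by_contra hne
      have h7 := hxd ⟨k, j, l⟩
      have h8 := hxd ⟨k, j', l⟩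
      rw [← h1] at h8
      have h9 := dist_triangle_left (foot ⟨k, j, l⟩) (foot ⟨k, j', l⟩) (x ⟨k, j, l⟩)
      have h10 : (1 / 2 : ℝ) ^ (a * (k : ℕ)) ≤ dist (foot ⟨k, j, l⟩) (foot ⟨k, j', l⟩) := by
        simp only [foot]
        rw [Subtype.dist_eq, dist_planePoint, sub_zero, abs_zero, add_zero, spikePos, spikePos,
          ← sub_mul, abs_mul, abs_of_pos (a := (1 / 2 : ℝ) ^ (a * (k : ℕ))) (by positivity)]
        refine le_mul_of_one_le_left (by positivity) ?_
        have h11 : ((j : ℕ) : ℤ) - ((j' : ℕ) : ℤ) ≠ 0 := by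
          intro h0
          exact hne (Fin.ext (by omega))
        exact_mod_cast Int.one_le_abs h11
      simp only [scale] at h7 h8
      rw [hzpow, pow_add, pow_add, pow_add] at h7 h8
      have h12 : (1 / 2 : ℝ) ^ c * (1 / 2) ^ 2 * (1 / 2) ^ (l : ℕ) ≤ 1 * (1 / 2) ^ 2 * 1 := by
        gcongr <;> exact pow_le_one₀ (by norm_num) (by norm_num)
      have h13 : (0 : ℝ) < (1 / 2) ^ (a * (k : ℕ)) := by positivity
      nlinarith
    rw [h6]
  have hsum : ∑ i : ι, 4 * (A - 1) / A * spikeHeight a i.1 = 4 * (A - 1) / A * L := by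
    rw [Fintype.sum_sigma, ← sum_spikeHeight a (4 * (A - 1) / A * L), Finset.sum_range]
    refine Finset.sum_congr rfl fun k _ => ?_
    simp only [Finset.sum_const, Finset.card_univ, Fintype.card_prod, Fintype.card_fin,
      Finset.card_range, nsmul_eq_mul, Nat.cast_mul]
    ring
  have hA1 : 0 < A - 1 := by linarith
  rw [← hsum, ENNReal.ofReal_sum_of_nonneg fun i _ => by have := spikeHeight_pos a i.1; positivity,
    ← tsum_fintype (L := .unconditional ι), betaSum]
  refine le_trans ?_ (ENNReal.tsum_comp_le_tsum_of_injective hinj _)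
  refine ENNReal.tsum_le_tsum fun i => ?_
  obtain ⟨k, j, l⟩ := i
  refine le_betaInf_rpow_mul_ediam_comb (j := j) k.2 j.2 hA (by positivity) ?_ ?_
    (hxd ⟨k, j, l⟩)
  · have h1 : (1 / 2 : ℝ) ^ (a * (k : ℕ)) * (1 / 2) ^ 2 * (1 / 2) ^ (l : ℕ) ≤ 1 * 1 * 1 := by
      gcongr <;> exact pow_le_one₀ (by norm_num) (by norm_num)
    have h2 : (2 : ℝ) ^ c * (1 / 2) ^ c = 1 := by rw [← mul_pow]; norm_num
    have h3 : A * (1 / 2) ^ c ≤ 1 :=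
      (mul_le_mul_of_nonneg_right hc (by positivity)).trans_eq h2
    simp only [scale]
    rw [hzpow, pow_add, pow_add, pow_add]
    calc A * ((1 / 2) ^ (a * (k : ℕ)) * ((1 / 2) ^ c * (1 / 2) ^ 2 * (1 / 2) ^ (l : ℕ)))
        = (A * (1 / 2) ^ c) * ((1 / 2) ^ (a * (k : ℕ)) * (1 / 2) ^ 2 * (1 / 2) ^ (l : ℕ)) := by ring
      _ ≤ 1 * (1 * 1 * 1) := by gcongr
      _ = 1 := by norm_num
  · have hl := l.2
    simp only [scale]
    rw [hzpow, spikeHeight]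
    calc (1 / 2 : ℝ) ^ (a * ((k : ℕ) + 1))
        ≤ (1 / 2) ^ (a * (k : ℕ) + (c + 2 + l) + c) :=
          pow_le_pow_of_le_one (by norm_num) (by norm_num) (by rw [mul_add]; omega)
      _ = 1 * ((1 / 2) ^ c * (1 / 2) ^ (a * (k : ℕ) + (c + 2 + l))) := by ring
      _ ≤ ((A - 1) * 2 ^ c) * ((1 / 2) ^ c * (1 / 2) ^ (a * (k : ℕ) + (c + 2 + l))) := by gcongr
      _ = (A - 1) * (1 / 2) ^ (a * (k : ℕ) + (c + 2 + l)) * (2 ^ c * (1 / 2) ^ c) := by ring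
      _ = (A - 1) * (1 / 2) ^ (a * (k : ℕ) + (c + 2 + l)) := by
          rw [← mul_pow]; norm_num

end Comb

/-! ### Bound and sharpness of the exponent -/

theorem theoremA :
    (∀ p : ℝ, 2 < p → ∀ (N : ℕ) (A : ℝ), 1 < A →
      ∃ C : ℝ≥0, ∀ (Γ : Type*) [MetricSpace Γ] [MeasurableSpace Γ] [BorelSpace Γ]
        [ConnectedSpace Γ] (X : ℤ → Set Γ),
        IsDoublingWith Γ N → IsNestedNets X →
          betaSum p A X ≤ (C : ℝ≥0∞) * μH[1] (Set.univ : Set Γ)) ∧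
    (∃ N : ℕ, ∀ A : ℝ, 1 < A → ∀ C : ℝ≥0,
      ∃ (Γ : Type) (_ : MetricSpace Γ) (_ : MeasurableSpace Γ) (_ : BorelSpace Γ)
        (_ : ConnectedSpace Γ) (X : ℤ → Set Γ),
        IsDoublingWith Γ N ∧ IsNestedNets X ∧
          (C : ℝ≥0∞) * μH[1] (Set.univ : Set Γ) < betaSum 2 A X) := by
  refine ⟨fun p hp N A hA => exists_betaSum_le hp N hA, 25, fun A hA C => ?_⟩
  have hA1 : 0 < A - 1 := by linarith
  obtain ⟨c, hc⟩ := pow_unbounded_of_one_lt (max A (1 / (A - 1))) (one_lt_two (α := ℝ))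
  obtain ⟨L, hL⟩ := exists_nat_gt (C * A / (A - 1))
  have hconn := isConnected_iff_connectedSpace.1 (isConnected_comb (2 * c + 2 + L))
  obtain ⟨X, hX⟩ := exists_isNestedNets (Γ := comb (2 * c + 2 + L)) (D := 8)
    fun x y => dist_le_of_mem_comb x.2 y.2
  refine ⟨comb (2 * c + 2 + L), inferInstance, inferInstance, inferInstance, hconn, X,
    isDoublingWith_subset_plane _, hX, ?_⟩
  have hle := le_betaSum_comb hA ((le_max_left _ _).trans hc.le) (by
    have := (le_max_right A _).trans hc.le
    rwa [div_le_iff₀ hA1, mul_comm] at this) rfl hX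
  refine lt_of_lt_of_le ?_ hle
  have hmeas : μH[1] (Set.univ : Set (comb (2 * c + 2 + L))) ≤ ENNReal.ofReal 4 := by
    rw [← isometry_subtype_coe.hausdorffMeasure_image (Or.inl zero_le_one), Set.image_univ,
      Subtype.range_coe, ENNReal.ofReal_ofNat]
    exact hausdorffMeasure_comb_le _
  calc (C : ℝ≥0∞) * μH[1] (Set.univ : Set (comb (2 * c + 2 + L)))
      ≤ ENNReal.ofReal C * ENNReal.ofReal 4 := by
        rw [ENNReal.ofReal_coe_nnreal]
        exact mul_le_mul_right hmeas _
    _ = ENNReal.ofReal (C * 4) := (ENNReal.ofReal_mul C.2).symm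
    _ < ENNReal.ofReal (4 * (A - 1) / A * L) := by
        rw [div_lt_iff₀ hA1] at hL
        have hpos : (C : ℝ) * 4 < 4 * (A - 1) / A * L := by
          rw [div_mul_eq_mul_div, lt_div_iff₀ (by linarith)]
          linarith
        exact (ENNReal.ofReal_lt_ofReal_iff_of_nonneg (by positivity)).2 hpos
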